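/- Let $\rho\ge 1$ and let $\mu$ be a probability measure on $\mathbb R$ with $\int_{\mathbb R}|x|^\rho\,\mu(dx)<+\infty$. Let $F(x)=\mu((-\infty,x])$ for $x\in\mathbb R$, and let $F^{-1}(u)=\inf\{x\in\mathbb R: F(x)\ge u\}$ for $u\in(0,1)$. For $N\ge 1$ let $$e_N(\mu,\rho)=\inf\Big\{\mathcal W_\rho\Big(\tfrac1N\sum_{i=1}^N\delta_{x_i},\mu\Big): -\infty<x_1\le x_2\le\cdots\le x_N<+\infty\Big\},$$ where $\mathcal W_\rho$ is the Wasserstein distance with index $\rho$, i.e. $\mathcal W_\rho^\rho(\nu,\eta)$ is the infimum of $\int|x-y|^\rho\,\pi(dx,dy)$ over all couplings $\pi$ of $\nu$ and $\eta$. For every $N\ge1$ this infimum is attained; let $x_1^N\le\cdots\le x_N^N$ be any points attaining it. Then \begin{align*} &\sup_{N\ge 1}N^{1/\rho}e_N(\mu,\rho)<+\infty \ \Longrightarrow\ \sup_{N\ge 1}N\left(\int_0^{\frac 1 N} \left|F^{-1}(u)-x^N_1\right|^{\rho}\,du+\int^1_{\frac{N-1}{N}} \left|F^{-1}(u)-x^N_N\right|^{\rho}\,du\right)<+\infty\\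 &\Longleftrightarrow\ \sup_{u\in(0,1/2]}\left(F^{-1}(1-u/2)-F^{-1}(1-u)+F^{-1}(u)-F^{-1}(u/2)\right)<+\infty\\ &\Longrightarrow\ \sup_{u\in(0,1/2]}\frac{F^{-1}(1-u)-F^{-1}(u)}{\ln(1/u)}<+\infty\ \Longleftrightarrow\ \exists\,\lambda\in(0,+\infty),\ \forall x\ge 0,\ F(-x)+1-F(x)\le \frac{e^{-\lambda x}}{\lambda}\\ &\Longrightarrow\ \sup_{N\ge 1}\frac{N^{1/\rho}}{1+\ln N}\,e_N(\mu,\rho)<+\infty. \end{align*} -/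

import Mathlib

open MeasureTheory

noncomputable section

namespace WassersteinGrid

/-- The Wasserstein distance with index `ρ` between two measures on the real line: the infimum
over all couplings `π` of `ν` and `η` of `(∫ |x - y|^ρ dπ)^(1/ρ)`, with values in `[0, ∞]`. -/
def wasserstein (ρ : ℝ) (ν η : Measure ℝ) : ENNReal :=
  (⨅ (π : Measure (ℝ × ℝ)) (_ : π.fst = ν ∧ π.snd = η),
    ∫⁻ p, edist p.1 p.2 ^ ρ ∂π) ^ (1 / ρ)

/-- The empirical measure `(1/N) ∑_{i=1}^N δ_{x i}`; only the values `x 1, …, x N` matter. -/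
def empirical (N : ℕ) (x : ℕ → ℝ) : Measure ℝ :=
  (N : ENNReal)⁻¹ • ∑ i ∈ Finset.Icc 1 N, Measure.dirac (x i)

/-- The minimal error `e_N(μ, ρ)`: the infimum of the Wasserstein distance between
`(1/N) ∑_{i=1}^N δ_{x i}` and `μ` over all real points `x 1 ≤ ⋯ ≤ x N`. -/
def minError (μ : Measure ℝ) (ρ : ℝ) (N : ℕ) : ENNReal :=
  ⨅ (x : ℕ → ℝ) (_ : MonotoneOn x (Set.Icc 1 N)), wasserstein ρ (empirical N x) μ

/-- The points `x 1 ≤ ⋯ ≤ x N` attain the infimum defining `e_N(μ, ρ)`. -/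
def IsOptimalGrid (μ : Measure ℝ) (ρ : ℝ) (N : ℕ) (x : ℕ → ℝ) : Prop :=
  MonotoneOn x (Set.Icc 1 N) ∧ wasserstein ρ (empirical N x) μ = minError μ ρ N

/-- The quantile function `F⁻¹(u) = inf {x : F(x) ≥ u}` of `μ`, meant for `0 < u < 1`,
where `F` is the cumulative distribution function of `μ`. -/
def quantile (μ : Measure ℝ) (u : ℝ) : ℝ :=
  sInf {x : ℝ | u ≤ ProbabilityTheory.cdf μ x}

/-- `∫_a^b |F⁻¹(u) - y|^ρ du`, for `0 ≤ a ≤ b ≤ 1`, with values in `[0, ∞]`. -/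
def cellError (μ : Measure ℝ) (ρ a b y : ℝ) : ENNReal :=
  ∫⁻ u in Set.Ioo a b, edist (quantile μ u) y ^ ρ

end WassersteinGrid

end

namespace WassersteinGrid

open Set Filter ProbabilityTheory
open scoped Topology ENNReal

/-! ### The quantile function -/

/-! On the line the monotone coupling is optimal, so the transport cost of a sorted grid is
`gridCost`: the sum over the cells `((i-1)/N, i/N)` of `∫ |F⁻¹(u) - x i|^ρ du`. The lower bound is
Kantorovich duality with an explicit potential (`gridCost_le_lintegral`). The problem thus
decouples: an optimal grid minimises the error cell by cell, and the extreme cells cost at most the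
whole sum.

Near 0, an error of order `1/N` on the first cell bounds the increments `F⁻¹(u) - F⁻¹(u/2)`, because
a single point cannot be close to two separated values (`sub_le_of_setLIntegral_le`, `sub_half_le`).
Conversely, bounded halving increments make `F⁻¹` grow at most logarithmically
(`sub_le_log_of_sub_half_le`), and powers of the logarithm are integrable, so the first cell costs
`O(1/N)`. The end near 1 follows by the point reflection `reflect`. Logarithmic growth over all of
`(0, 1/2]` is the third condition, and inverting `F⁻¹` turns it into exponential tails.

For the final bound, the grid of quantiles at cell midpoints is tested. Each extreme cell costs
`O((1 + log N)^ρ / N)`, and the inner cells together cost at most the `ρ`-th power of the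
oscillation of `F⁻¹` on `[1/N, 1 - 1/N]`, divided by `N`, which has the same order. -/

theorem quantile_le_iff (μ : Measure ℝ) {u : ℝ} (hu0 : 0 < u) (hu1 : u < 1) (x : ℝ) :
    quantile μ u ≤ x ↔ u ≤ cdf μ x := by
  set S := {x : ℝ | u ≤ cdf μ x} with hS
  have hne : S.Nonempty :=
    (((tendsto_cdf_atTop μ).eventually (eventually_gt_nhds hu1)).exists).imp fun _ h => le_of_lt h
  have hbdd : BddBelow S := by
    obtain ⟨b, hb⟩ := ((tendsto_cdf_atBot μ).eventually (eventually_lt_nhds hu0)).exists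
    refine ⟨b, fun y hy => ?_⟩
    by_contra! h
    exact absurd (hy.trans (monotone_cdf μ h.le)) (not_le.2 hb)
  refine ⟨fun h => ?_, fun h => csInf_le hbdd h⟩
  have hx : ∀ y, x < y → u ≤ cdf μ y := fun y hy => by
    obtain ⟨z, hz, hzy⟩ := exists_lt_of_csInf_lt hne (lt_of_le_of_lt h hy)
    exact le_trans hz (monotone_cdf μ hzy.le)
  -- Right continuity of the distribution function shows that the infimum is attained.
  have hc : Tendsto (cdf μ) (𝓝[>] x) (𝓝 (cdf μ x)) :=
    ((cdf μ).right_continuous x).tendsto.mono_left (nhdsWithin_mono _ Ioi_subset_Ici_self)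
  exact ge_of_tendsto hc (eventually_nhdsWithin_of_forall hx)

theorem monotoneOn_quantile (μ : Measure ℝ) : MonotoneOn (quantile μ) (Ioo 0 1) := by
  intro u hu v hv huv
  rw [quantile_le_iff μ hu.1 hu.2]
  exact huv.trans ((quantile_le_iff μ hv.1 hv.2 _).1 le_rfl)

theorem aemeasurable_quantile (μ : Measure ℝ) :
    AEMeasurable (quantile μ) (volume.restrict (Ioo 0 1)) :=
  aemeasurable_restrict_of_monotoneOn measurableSet_Ioo (monotoneOn_quantile μ)

instance : IsProbabilityMeasure (volume.restrict (Ioo (0 : ℝ) 1)) :=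
  ⟨by simp⟩

theorem map_quantile (μ : Measure ℝ) [IsProbabilityMeasure μ] :
    (volume.restrict (Ioo (0 : ℝ) 1)).map (quantile μ) = μ := by
  have := Measure.isProbabilityMeasure_map (aemeasurable_quantile μ)
  refine Measure.ext_of_Iic _ _ fun x => ?_
  rw [Measure.map_apply_of_aemeasurable (aemeasurable_quantile μ) measurableSet_Iic, ← ofReal_cdf μ,
    Measure.restrict_apply' measurableSet_Ioo]
  have h : quantile μ ⁻¹' Iic x ∩ Ioo 0 1 = Iic (cdf μ x) ∩ Ioo 0 1 := by
    ext u
    simp only [mem_inter_iff, mem_preimage, mem_Iic]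
    exact and_congr_left fun hu => quantile_le_iff μ hu.1 hu.2 x
  rw [h]
  have h0 := cdf_nonneg μ x
  have h1 := cdf_le_one μ x
  rw [← Measure.restrict_apply' measurableSet_Ioo, restrict_Ioo_eq_restrict_Ioc,
    Measure.restrict_apply' measurableSet_Ioc]
  have : Iic (cdf μ x) ∩ Ioc 0 1 = Ioc 0 (cdf μ x) := by
    ext u; simp only [mem_inter_iff, mem_Iic, mem_Ioc]; grind
  rw [this, Real.volume_Ioc, sub_zero]

/-! ### The cells `((i - 1) / N, i / N)` -/

/-- Lebesgue measure on the `i`-th of the `N` cells of the unit interval. -/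
noncomputable def cell (N i : ℕ) : Measure ℝ := volume.restrict (Ioo (((i : ℝ) - 1) / N) ((i : ℝ) / N))

theorem cellError_cell (μ : Measure ℝ) (ρ y : ℝ) (N i : ℕ) :
    cellError μ ρ (((i : ℝ) - 1) / N) ((i : ℝ) / N) y =
      ∫⁻ u, edist (quantile μ u) y ^ ρ ∂(cell N i) := rfl

theorem cell_univ {N : ℕ} (hN : 1 ≤ N) (i : ℕ) : cell N i univ = (N : ℝ≥0∞)⁻¹ := by
  have hN' : (0 : ℝ) < N := by exact_mod_cast hN
  rw [cell, Measure.restrict_apply_univ, Real.volume_Ioo, ← sub_div, sub_sub_cancel, one_div,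
    ENNReal.ofReal_inv_of_pos hN', ENNReal.ofReal_natCast]

theorem sum_cell {N : ℕ} (hN : 1 ≤ N) :
    ∑ i ∈ Finset.Icc 1 N, cell N i = volume.restrict (Ioo (0 : ℝ) 1) := by
  have hN' : (0 : ℝ) < N := by exact_mod_cast hN
  have key : ∀ k : ℕ, ∑ i ∈ Finset.Icc 1 k, cell N i = volume.restrict (Ioc (0 : ℝ) (k / N)) := by
    intro k
    induction k with
    | zero => simp
    | succ k ih =>
      rw [Finset.sum_Icc_succ_top (by omega), ih, cell, restrict_Ioo_eq_restrict_Ioc,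
        ← Measure.restrict_union]
      · congr 1
        push_cast
        rw [add_sub_cancel_right]
        exact Ioc_union_Ioc_eq_Ioc (by positivity) (by gcongr; linarith)
      · push_cast
        rw [add_sub_cancel_right]
        exact Ioc_disjoint_Ioc_of_le le_rfl
      · exact measurableSet_Ioc
  rw [key, div_self hN'.ne', restrict_Ioo_eq_restrict_Ioc]

theorem cell_le {N i : ℕ} (hi : i ∈ Finset.Icc 1 N) :
    cell N i ≤ volume.restrict (Ioo (0 : ℝ) 1) := by
  rw [← sum_cell (N := N) (by rw [Finset.mem_Icc] at hi; omega)]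
  exact Finset.single_le_sum (f := fun i => cell N i) (fun _ _ => Measure.zero_le _) hi

theorem memLp_quantile (μ : Measure ℝ) [IsProbabilityMeasure μ] {ρ : ℝ} (hρ : 1 ≤ ρ)
    (hμ : Integrable (fun x : ℝ => |x| ^ ρ) μ) :
    MemLp (quantile μ) (ENNReal.ofReal ρ) (volume.restrict (Ioo 0 1)) := by
  have h : MemLp (fun x : ℝ => x) (ENNReal.ofReal ρ) μ := by
    rw [← integrable_norm_rpow_iff (f := fun x : ℝ => x) measurable_id.aestronglyMeasurable
      (by simpa using by linarith) ENNReal.ofReal_ne_top, ENNReal.toReal_ofReal (by linarith)]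
    simpa using hμ
  rw [← map_quantile μ] at h
  exact (memLp_map_measure_iff measurable_id.aestronglyMeasurable (aemeasurable_quantile μ)).1 h

/-! ### The monotone coupling is optimal -/

/-- The cost `∑ i, ∫_{(i-1)/N}^{i/N} |F⁻¹(u) - x i|^ρ du` of coupling the `i`-th atom with the
`i`-th cell. -/
noncomputable def gridCost (μ : Measure ℝ) (ρ : ℝ) (N : ℕ) (x : ℕ → ℝ) : ℝ≥0∞ :=
  ∑ i ∈ Finset.Icc 1 N, ∫⁻ u, edist (quantile μ u) (x i) ^ ρ ∂(cell N i)

/-- The infimum of the transport cost over all couplings. -/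
noncomputable def transportCost (ρ : ℝ) (ν η : Measure ℝ) : ℝ≥0∞ :=
  ⨅ (π : Measure (ℝ × ℝ)) (_ : π.fst = ν ∧ π.snd = η), ∫⁻ p, edist p.1 p.2 ^ ρ ∂π

theorem wasserstein_eq (ρ : ℝ) (ν η : Measure ℝ) :
    wasserstein ρ ν η = transportCost ρ ν η ^ (1 / ρ) := rfl

theorem edist_rpow_eq_ofReal {ρ : ℝ} (hρ : 0 ≤ ρ) (a b : ℝ) :
    edist a b ^ ρ = ENNReal.ofReal (|a - b| ^ ρ) := by
  rw [edist_dist, Real.dist_eq, ENNReal.ofReal_rpow_of_nonneg (abs_nonneg _) hρ]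

/-- Sending the `i`-th cell to the `i`-th atom is a coupling whether or not the points are sorted.
This freedom later allows competitors that are not monotone. -/
theorem transportCost_le_gridCost (μ : Measure ℝ) [IsProbabilityMeasure μ] (ρ : ℝ) {N : ℕ}
    (hN : 1 ≤ N) (x : ℕ → ℝ) : transportCost ρ (empirical N x) μ ≤ gridCost μ ρ N x := by
  have hQ : ∀ i ∈ Finset.Icc 1 N, AEMeasurable (quantile μ) (cell N i) := fun i hi =>
    (aemeasurable_quantile μ).mono_measure (cell_le hi)
  have hp : ∀ i ∈ Finset.Icc 1 N, AEMeasurable (fun u => (x i, quantile μ u)) (cell N i) :=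
    fun i hi => aemeasurable_const.prodMk (hQ i hi)
  set π : Measure (ℝ × ℝ) :=
    ∑ i ∈ Finset.Icc 1 N, (cell N i).map (fun u => (x i, quantile μ u)) with hπ
  have hfst : π.fst = empirical N x := by
    rw [Measure.fst, hπ, Measure.map_finset_sum measurable_fst.aemeasurable, empirical,
      Finset.smul_sum]
    refine Finset.sum_congr rfl fun i hi => ?_
    rw [← Measure.fst, Measure.fst_map_prodMk₀ (hQ i hi), Measure.map_const, cell_univ hN]
  have hsnd : π.snd = μ := by
    rw [Measure.snd, hπ, Measure.map_finset_sum measurable_snd.aemeasurable]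
    conv_rhs => rw [← map_quantile μ, ← sum_cell hN]
    rw [Measure.map_finset_sum (by rw [sum_cell hN]; exact aemeasurable_quantile μ)]
    refine Finset.sum_congr rfl fun i hi => ?_
    rw [← Measure.snd, Measure.snd_map_prodMk₀ aemeasurable_const]
  refine (iInf₂_le π ⟨hfst, hsnd⟩).trans_eq ?_
  rw [hπ, lintegral_finsetSum_measure, gridCost]
  refine Finset.sum_congr rfl fun i hi => ?_
  rw [lintegral_map' (by fun_prop) (hp i hi)]
  simp_rw [edist_comm (x i)]

/-! ### Convexity of the cost and the discrete dual potential -/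

theorem convexOn_abs_rpow {ρ : ℝ} (hρ : 1 ≤ ρ) : ConvexOn ℝ univ fun t : ℝ => |t| ^ ρ := by
  refine ⟨convex_univ, fun s _ t _ a b ha hb hab => ?_⟩
  refine le_trans (Real.rpow_le_rpow (abs_nonneg _) ?_ (by linarith))
    ((convexOn_rpow hρ).2 (abs_nonneg s) (abs_nonneg t) ha hb hab)
  refine (abs_add_le _ _).trans ?_
  simp [abs_mul, abs_of_nonneg ha, abs_of_nonneg hb]

/-- Increments of a convex function are monotone. -/
theorem _root_.ConvexOn.sub_le_sub_add {f : ℝ → ℝ} (hf : ConvexOn ℝ univ f) {s t d : ℝ}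
    (hst : s ≤ t) (hd : 0 ≤ d) : f (s + d) - f s ≤ f (t + d) - f t := by
  rcases hd.eq_or_lt with rfl | hd
  · simp
  have hL : 0 < t + d - s := by linarith
  have hp : 0 ≤ (t - s) / (t + d - s) := div_nonneg (by linarith) hL.le
  have hq : 0 ≤ d / (t + d - s) := by positivity
  have e3 : (t - s) / (t + d - s) + d / (t + d - s) = 1 := by field_simp; ring
  -- The points `s + d` and `t` are convex combinations of `s` and `t + d` with exchanged weights;
  -- the two convexity inequalities are added.
  have h1 := hf.2 (mem_univ s) (mem_univ (t + d)) hp hq e3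
  have h2 := hf.2 (mem_univ s) (mem_univ (t + d)) hq hp (by rw [add_comm, e3])
  have e1 : ((t - s) / (t + d - s)) • s + (d / (t + d - s)) • (t + d) = s + d := by
    simp only [smul_eq_mul]; field_simp; ring
  have e2 : (d / (t + d - s)) • s + ((t - s) / (t + d - s)) • (t + d) = t := by
    simp only [smul_eq_mul]; field_simp; ring
  rw [e1] at h1
  rw [e2] at h2
  simp only [smul_eq_mul] at h1 h2
  have := add_le_add h1 h2
  have e4 : (t - s) / (t + d - s) = 1 - d / (t + d - s) := by linarith
  rw [e4] at this
  linarith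

theorem abs_rpow_sub_le {ρ : ℝ} (hρ : 1 ≤ ρ) {a b y q : ℝ} (hab : a ≤ b) (hyq : y ≤ q) :
    |b - q| ^ ρ - |a - q| ^ ρ ≤ |b - y| ^ ρ - |a - y| ^ ρ := by
  have h := (convexOn_abs_rpow hρ).sub_le_sub_add (s := a - q) (t := a - y) (d := b - a)
    (by linarith) (by linarith)
  simpa [show a - q + (b - a) = b - q by ring, show a - y + (b - a) = b - y by ring] using h

/-- The dual potential of the discrete measure. It is constant outside the intervals
`[x i, x (i + 1)]`, and on these its increments are those of `|· - q i| ^ ρ`. -/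
noncomputable def potential (ρ : ℝ) (N : ℕ) (x q : ℕ → ℝ) (z : ℝ) : ℝ :=
  ∑ i ∈ Finset.Ico 1 N, (|max (x i) (min z (x (i + 1))) - q i| ^ ρ - |x i - q i| ^ ρ)

/-- Since the points are sorted, between `x k` and `x (k + 1)` only the `k`-th summand moves: those
with smaller index are already saturated and those with larger index have not started. -/
theorem potential_succ {ρ : ℝ} {N : ℕ} {x q : ℕ → ℝ} (hx : MonotoneOn x (Icc 1 N)) {k : ℕ}
    (hk : k ∈ Finset.Ico 1 N) :
    potential ρ N x q (x (k + 1)) - potential ρ N x q (x k) =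
      |x (k + 1) - q k| ^ ρ - |x k - q k| ^ ρ := by
  rw [Finset.mem_Ico] at hk
  have hmono : ∀ i j, 1 ≤ i → i ≤ j → j ≤ N → x i ≤ x j := fun i j h1 h2 h3 =>
    hx ⟨h1, h2.trans h3⟩ ⟨h1.trans h2, h3⟩ h2
  rw [potential, potential, ← Finset.sum_sub_distrib, Finset.sum_eq_single_of_mem k
    (Finset.mem_Ico.2 hk)]
  · have := hmono k (k + 1) hk.1 (by omega) hk.2
    simp [this]
  · intro i hi hik
    rw [Finset.mem_Ico] at hi
    have h0 := hmono i (i + 1) hi.1 (by omega) hi.2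
    rcases lt_or_gt_of_ne hik with h | h
    · have h1 := hmono (i + 1) k (by omega) (by omega) (by omega)
      have h2 := hmono (i + 1) (k + 1) (by omega) (by omega) (by omega)
      simp [h1, h2]
    · have h1 := hmono (k + 1) i (by omega) (by omega) (by omega)
      have h2 := hmono k i (by omega) (by omega) (by omega)
      simp [h1, h2, h1.trans h0, h2.trans h0]

/-- From `k` to `k + 1` the expression changes by the increment of `|· - y|^ρ` minus that of `|· - q
k|^ρ`. By `abs_rpow_sub_le` this is nonnegative when `y ≤ q k` and nonpositive when `q k ≤ y`, so
the expression decreases up to `i` and increases afterwards. -/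
theorem sub_potential_le {ρ : ℝ} (hρ : 1 ≤ ρ) {N : ℕ} {x q : ℕ → ℝ}
    (hx : MonotoneOn x (Icc 1 N)) {i j : ℕ} (hi : i ∈ Finset.Icc 1 N) (hj : j ∈ Finset.Icc 1 N)
    {y : ℝ} (hlow : ∀ k ∈ Finset.Ico 1 N, k < i → q k ≤ y)
    (hhigh : ∀ k ∈ Finset.Ico 1 N, i ≤ k → y ≤ q k) :
    |x i - y| ^ ρ - potential ρ N x q (x i) ≤ |x j - y| ^ ρ - potential ρ N x q (x j) := by
  rw [Finset.mem_Icc] at hi hj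
  set G : ℕ → ℝ := fun k => |x k - y| ^ ρ - potential ρ N x q (x k) with hG
  have hstep : ∀ k ∈ Finset.Ico 1 N, x k ≤ x (k + 1) := fun k hk => by
    rw [Finset.mem_Ico] at hk
    exact hx ⟨hk.1, hk.2.le⟩ ⟨by omega, hk.2⟩ (by omega)
  change G i ≤ G j
  rcases le_total i j with h | h
  · suffices H : ∀ m, i ≤ m → m ≤ N → G i ≤ G m from H j h hj.2
    intro m hm
    induction m, hm using Nat.le_induction with
    | base => exact fun _ => le_rfl
    | succ m hm ih =>
      intro hmN
      have hk : m ∈ Finset.Ico 1 N := Finset.mem_Ico.2 ⟨by omega, by omega⟩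
      have h1 := abs_rpow_sub_le hρ (hstep m hk) (hhigh m hk hm)
      have h2 := potential_succ (ρ := ρ) (q := q) hx hk
      have h3 := ih (by omega)
      simp only [hG] at h3 ⊢
      linarith
  · suffices H : ∀ m, j ≤ m → m ≤ i → G m ≤ G j from H i h le_rfl
    intro m hm
    induction m, hm using Nat.le_induction with
    | base => exact fun _ => le_rfl
    | succ m hm ih =>
      intro hmi
      have hk : m ∈ Finset.Ico 1 N := Finset.mem_Ico.2 ⟨by omega, by omega⟩
      have h1 := abs_rpow_sub_le hρ (hstep m hk) (hlow m hk (by omega))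
      have h2 := potential_succ (ρ := ρ) (q := q) hx hk
      have h3 := ih (by omega)
      simp only [hG] at h3 ⊢
      linarith

/-! ### Integration against the empirical measure and Kantorovich duality -/

theorem ofReal_integral_le {α : Type*} [MeasurableSpace α] {ν : Measure α} {f : α → ℝ}
    (hf : Integrable f ν) : ENNReal.ofReal (∫ a, f a ∂ν) ≤ ∫⁻ a, ENNReal.ofReal (f a) ∂ν := by
  have h := ofReal_integral_eq_lintegral_ofReal hf.pos_part
    (Eventually.of_forall fun a => le_max_right _ _)
  have h' : ∀ a, ENNReal.ofReal (max (f a) 0) = ENNReal.ofReal (f a) := fun a => by simp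
  simp_rw [h'] at h
  rw [← h]
  exact ENNReal.ofReal_le_ofReal (integral_mono hf hf.pos_part fun a => le_max_left _ _)

theorem continuous_potential {ρ : ℝ} (hρ : 0 ≤ ρ) (N : ℕ) (x q : ℕ → ℝ) :
    Continuous (potential ρ N x q) := by
  unfold potential
  refine continuous_finsetSum _ fun i _ => Continuous.sub ?_ continuous_const
  exact Continuous.rpow_const (by fun_prop) fun _ => Or.inr hρ

theorem integrable_empirical {N : ℕ} (hN : 1 ≤ N) (x : ℕ → ℝ) (f : ℝ → ℝ) :
    Integrable f (empirical N x) := by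
  refine Integrable.smul_measure ?_ (by simp; omega)
  exact integrable_finsetSum_measure.2 fun i _ => integrable_dirac (by simp)

theorem integral_empirical (N : ℕ) (x : ℕ → ℝ) (f : ℝ → ℝ) :
    ∫ z, f z ∂(empirical N x) = ∑ i ∈ Finset.Icc 1 N, (N : ℝ)⁻¹ * f (x i) := by
  rw [empirical, integral_smul_measure, integral_finsetSum_measure
    fun i _ => integrable_dirac (by simp), Finset.smul_sum]
  simp

theorem ae_empirical (N : ℕ) (x : ℕ → ℝ) :
    ∀ᵐ z ∂(empirical N x), ∃ i ∈ Finset.Icc 1 N, z = x i := by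
  refine Measure.ae_smul_measure ?_ _
  rw [ae_iff, Measure.finsetSum_apply]
  refine Finset.sum_eq_zero fun i hi => ?_
  rw [← ae_iff, ae_dirac_eq]
  exact ⟨i, hi, rfl⟩

/-- With `ψ` the conjugate of `φ`, the inequality `φ a + ψ b ≤ |a - b|^ρ` holds for every atom `a`,
with equality on the monotone coupling. The integral of `φ + ψ` depends only on the marginals, so it
equals the cost of the monotone coupling and bounds that of any other. -/
theorem gridCost_le_lintegral (μ : Measure ℝ) [IsProbabilityMeasure μ] {ρ : ℝ} (hρ : 1 ≤ ρ)
    (hμ : Integrable (fun x : ℝ => |x| ^ ρ) μ) {N : ℕ} (hN : 1 ≤ N) {x : ℕ → ℝ}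
    (hx : MonotoneOn x (Icc 1 N)) {π : Measure (ℝ × ℝ)} (hfst : π.fst = empirical N x)
    (hsnd : π.snd = μ) : gridCost μ ρ N x ≤ ∫⁻ p, edist p.1 p.2 ^ ρ ∂π := by
  have hρ0 : 0 ≤ ρ := by linarith
  have hNpos : (0 : ℝ) < N := by exact_mod_cast hN
  -- The quantiles at the cell boundaries separate the values of `F⁻¹` on consecutive cells; only
  -- the indices `1 ≤ i < N` enter the potential.
  set q : ℕ → ℝ := fun i => quantile μ (i / N) with hq
  set φ := potential ρ N x q with hφ
  have hne : (Finset.Icc 1 N).Nonempty := ⟨1, by simp [hN]⟩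
  set ψ : ℝ → ℝ := fun y => (Finset.Icc 1 N).inf' hne fun i => |x i - y| ^ ρ - φ (x i) with hψ
  have hψc : Continuous ψ := by
    refine Continuous.finset_inf'_apply hne fun i _ => Continuous.sub ?_ continuous_const
    exact Continuous.rpow_const (by fun_prop) fun _ => Or.inr hρ0
  have hid : MemLp (fun y : ℝ => y) (ENNReal.ofReal ρ) μ := by
    rw [← integrable_norm_rpow_iff (f := fun x : ℝ => x) measurable_id.aestronglyMeasurable
      (by simpa using by linarith) ENNReal.ofReal_ne_top, ENNReal.toReal_ofReal (by linarith)]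
    simpa using hμ
  have hcost : ∀ a : ℝ, Integrable (fun y => |a - y| ^ ρ) μ := fun a => by
    have := ((memLp_const a).sub hid).integrable_norm_rpow (by simpa using by linarith)
      ENNReal.ofReal_ne_top
    simpa [ENNReal.toReal_ofReal hρ0] using this
  have hψi : Integrable ψ μ := by
    refine Integrable.mono' (g := fun y => ∑ i ∈ Finset.Icc 1 N, |(|x i - y| ^ ρ - φ (x i))|)
      (integrable_finsetSum _ fun i _ => ((hcost (x i)).sub (integrable_const _)).abs)
      hψc.aestronglyMeasurable (Eventually.of_forall fun y => ?_)
    obtain ⟨i, hi, h⟩ := Finset.exists_mem_eq_inf' hne fun i => |x i - y| ^ ρ - φ (x i)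
    rw [hψ, Real.norm_eq_abs]
    simp only [h]
    exact Finset.single_le_sum (f := fun i => |(|x i - y| ^ ρ - φ (x i))|)
      (fun _ _ => abs_nonneg _) hi
  have hψQ : Integrable (fun u => ψ (quantile μ u)) (volume.restrict (Ioo 0 1)) := by
    have := hψi
    rw [← map_quantile μ] at this
    exact this.comp_aemeasurable (aemeasurable_quantile μ)
  have hcellQ : ∀ i ∈ Finset.Icc 1 N, Integrable (fun u => ψ (quantile μ u)) (cell N i) :=
    fun i hi => hψQ.mono_measure (cell_le hi)
  have hfin : ∀ i, IsFiniteMeasure (cell N i) := fun i =>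
    ⟨by rw [cell_univ hN]; simp; omega⟩
  -- Complementary slackness: for `u` in the `i`-th cell, the minimum defining `ψ (F⁻¹ u)` is
  -- attained at `x i`.
  have hpt : ∀ i ∈ Finset.Icc 1 N, ∀ᵐ u ∂(cell N i),
      |quantile μ u - x i| ^ ρ = φ (x i) + ψ (quantile μ u) := by
    intro i hi
    have hi' := Finset.mem_Icc.1 hi
    filter_upwards [ae_restrict_mem measurableSet_Ioo] with u hu
    have hu0 : 0 < u := lt_of_le_of_lt (div_nonneg (by
      have : (1 : ℝ) ≤ i := by exact_mod_cast hi'.1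
      linarith) hNpos.le) hu.1
    have hu1 : u < 1 := lt_of_lt_of_le hu.2 ((div_le_one hNpos).2 (by exact_mod_cast hi'.2))
    have hqmem : ∀ k ∈ Finset.Ico 1 N, (k : ℝ) / N ∈ Ioo (0 : ℝ) 1 := fun k hk => by
      rw [Finset.mem_Ico] at hk
      have : (0 : ℝ) < k := by exact_mod_cast hk.1
      exact ⟨by positivity, (div_lt_one hNpos).2 (by exact_mod_cast hk.2)⟩
    have hmin : ψ (quantile μ u) = |x i - quantile μ u| ^ ρ - φ (x i) := by
      refine le_antisymm (Finset.inf'_le _ hi) (Finset.le_inf' _ _ fun j hj => ?_)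
      refine sub_potential_le hρ hx hi hj (fun k hk hki => ?_) fun k hk hki => ?_
      · refine monotoneOn_quantile μ (hqmem k hk) ⟨hu0, hu1⟩ (le_trans ?_ hu.1.le)
        have : (k : ℝ) + 1 ≤ i := by exact_mod_cast hki
        gcongr
        linarith
      · refine monotoneOn_quantile μ ⟨hu0, hu1⟩ (hqmem k hk) (hu.2.le.trans ?_)
        gcongr
    rw [hmin, abs_sub_comm]
    ring
  have hcell : ∀ i ∈ Finset.Icc 1 N, ∫⁻ u, edist (quantile μ u) (x i) ^ ρ ∂(cell N i) =
      ENNReal.ofReal ((N : ℝ)⁻¹ * φ (x i) + ∫ u, ψ (quantile μ u) ∂(cell N i)) := by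
    intro i hi
    have h1 : ∫⁻ u, edist (quantile μ u) (x i) ^ ρ ∂(cell N i) =
        ∫⁻ u, ENNReal.ofReal (φ (x i) + ψ (quantile μ u)) ∂(cell N i) := by
      refine lintegral_congr_ae ?_
      filter_upwards [hpt i hi] with u hu
      rw [edist_rpow_eq_ofReal hρ0, hu]
    rw [h1, ← ofReal_integral_eq_lintegral_ofReal (f := fun u => φ (x i) + ψ (quantile μ u))
      ((integrable_const _).add (hcellQ i hi)),
      integral_add (integrable_const _) (hcellQ i hi), integral_const, Measure.real, cell_univ hN]
    · simp
    · filter_upwards [hpt i hi] with u hu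
      rw [Pi.zero_apply, ← hu]
      positivity
  have hnn : ∀ i ∈ Finset.Icc 1 N,
      0 ≤ (N : ℝ)⁻¹ * φ (x i) + ∫ u, ψ (quantile μ u) ∂(cell N i) := by
    intro i hi
    have : (N : ℝ)⁻¹ * φ (x i) + ∫ u, ψ (quantile μ u) ∂(cell N i) =
        ∫ u, |quantile μ u - x i| ^ ρ ∂(cell N i) := by
      rw [integral_congr_ae (hpt i hi), integral_add (integrable_const _) (hcellQ i hi),
        integral_const, Measure.real, cell_univ hN]
      simp
    rw [this]
    exact integral_nonneg fun u => by positivity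
  have hφπ : Integrable (fun p : ℝ × ℝ => φ p.1) π := by
    have := integrable_empirical hN x φ
    rw [← hfst] at this
    exact this.comp_measurable measurable_fst
  have hψπ : Integrable (fun p : ℝ × ℝ => ψ p.2) π := by
    have := hψi
    rw [← hsnd] at this
    exact this.comp_measurable measurable_snd
  have hsum : gridCost μ ρ N x = ENNReal.ofReal (∫ p, (φ p.1 + ψ p.2) ∂π) := by
    rw [gridCost, Finset.sum_congr rfl hcell, ← ENNReal.ofReal_sum_of_nonneg hnn,
      Finset.sum_add_distrib, integral_add hφπ hψπ]
    congr 2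
    · rw [← integral_empirical, ← hfst, Measure.fst, integral_map measurable_fst.aemeasurable
        (continuous_potential hρ0 _ _ _).aestronglyMeasurable]
    · rw [← integral_finsetSum_measure hcellQ, sum_cell hN, ← integral_map
        (aemeasurable_quantile μ) hψc.aestronglyMeasurable, map_quantile]
      conv_lhs => rw [← hsnd]
      rw [Measure.snd, integral_map measurable_snd.aemeasurable hψc.aestronglyMeasurable]
  rw [hsum]
  -- The function `φ + ψ` may be negative, so its integral is only bounded by the integral of its
  -- positive part.
  refine (ofReal_integral_le (hφπ.add hψπ)).trans (lintegral_mono_ae ?_)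
  have hae : ∀ᵐ p ∂π, ∃ i ∈ Finset.Icc 1 N, p.1 = x i := by
    have := ae_empirical N x
    rw [← hfst] at this
    exact ae_of_ae_map measurable_fst.aemeasurable this
  filter_upwards [hae] with p ⟨i, hi, hp⟩
  rw [edist_rpow_eq_ofReal hρ0]
  refine ENNReal.ofReal_le_ofReal ?_
  have : ψ p.2 ≤ |x i - p.2| ^ ρ - φ (x i) := Finset.inf'_le _ hi
  change φ p.1 + ψ p.2 ≤ |p.1 - p.2| ^ ρ
  rw [hp]
  linarith

theorem transportCost_eq_gridCost (μ : Measure ℝ) [IsProbabilityMeasure μ] {ρ : ℝ} (hρ : 1 ≤ ρ)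
    (hμ : Integrable (fun x : ℝ => |x| ^ ρ) μ) {N : ℕ} (hN : 1 ≤ N) {x : ℕ → ℝ}
    (hx : MonotoneOn x (Icc 1 N)) :
    transportCost ρ (empirical N x) μ = gridCost μ ρ N x :=
  le_antisymm (transportCost_le_gridCost μ ρ hN x) <|
    le_iInf₂ fun _ h => gridCost_le_lintegral μ hρ hμ hN hx h.1 h.2

/-! ### Optimal grids -/

theorem sum_Icc_one_eq_sum_fin {M : Type*} [AddCommMonoid M] (N : ℕ) (F : ℕ → M) :
    ∑ i ∈ Finset.Icc 1 N, F i = ∑ k : Fin N, F (k + 1) := by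
  rw [Fin.sum_univ_eq_sum_range (fun k => F (k + 1))]
  induction N with
  | zero => simp
  | succ N ih => rw [Finset.sum_Icc_succ_top (by omega), Finset.sum_range_succ, ih]

/-- Sorting leaves the empirical measure unchanged. Indices are shifted by one to pass to `Fin N`;
the default value 0 is never used on `1, …, N`. -/
theorem exists_monotoneOn_empirical_eq (N : ℕ) (x : ℕ → ℝ) :
    ∃ y : ℕ → ℝ, MonotoneOn y (Icc 1 N) ∧ empirical N y = empirical N x := by
  set f : Fin N → ℝ := fun k => x (k + 1) with hf
  have hmono : Monotone (f ∘ Tuple.sort f) := Tuple.monotone_sort f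
  refine ⟨fun i => if h : i - 1 < N then f (Tuple.sort f ⟨i - 1, h⟩) else 0, ?_, ?_⟩
  · intro i hi j hj hij
    have hi' : i - 1 < N := by have := hi.1; have := hi.2; omega
    have hj' : j - 1 < N := by have := hj.1; have := hj.2; omega
    simp only [hi', hj', dif_pos]
    exact hmono (Fin.mk_le_mk.2 (by omega))
  · rw [empirical, empirical, sum_Icc_one_eq_sum_fin, sum_Icc_one_eq_sum_fin]
    congr 1
    simp only [add_tsub_cancel_right, Fin.is_lt, dif_pos, Fin.eta]
    exact Equiv.sum_comp (Tuple.sort f) fun k => Measure.dirac (f k)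

theorem exists_forall_norm_sub_smul_le {V : Type*} [NormedAddCommGroup V] [NormedSpace ℝ V]
    (v e : V) (he : e ≠ 0) : ∃ y : ℝ, ∀ z : ℝ, ‖v - y • e‖ ≤ ‖v - z • e‖ := by
  refine Continuous.exists_forall_le (by fun_prop) ?_
  have he' : 0 < ‖e‖ := norm_pos_iff.2 he
  have h : Tendsto (fun z : ℝ => ‖z‖ * ‖e‖ - ‖v‖) (cocompact ℝ) atTop :=
    tendsto_atTop_add_const_right _ _ (tendsto_norm_cocompact_atTop.atTop_mul_const he')
  refine tendsto_atTop_mono (fun z => ?_) h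
  have := norm_sub_norm_le (z • e) v
  rwa [norm_smul, norm_sub_rev] at this

theorem lintegral_edist_rpow_eq {α : Type*} [MeasurableSpace α] {ν : Measure α} (f : α → ℝ)
    {ρ : ℝ} (hρ : 1 ≤ ρ) (y : ℝ) :
    ∫⁻ u, edist (f u) y ^ ρ ∂ν = eLpNorm (fun u => f u - y) (ENNReal.ofReal ρ) ν ^ ρ := by
  rw [eLpNorm_eq_lintegral_rpow_enorm_toReal (by simpa using by linarith) ENNReal.ofReal_ne_top,
    ENNReal.toReal_ofReal (by linarith), ← ENNReal.rpow_mul, one_div,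
    inv_mul_cancel₀ (by linarith), ENNReal.rpow_one]
  simp_rw [edist_eq_enorm_sub]

/-- The integral is the `ρ`-th power of the `L^ρ` distance from `f` to a constant, and the distance
to the line of constants is attained by coercivity. -/
theorem exists_forall_lintegral_edist_le {α : Type*} [MeasurableSpace α] {ν : Measure α}
    [IsFiniteMeasure ν] (hν : ν ≠ 0) {f : α → ℝ} {ρ : ℝ} (hρ : 1 ≤ ρ)
    (hf : MemLp f (ENNReal.ofReal ρ) ν) :
    ∃ y : ℝ, ∀ z : ℝ, ∫⁻ u, edist (f u) y ^ ρ ∂ν ≤ ∫⁻ u, edist (f u) z ^ ρ ∂ν := by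
  have : Fact (1 ≤ ENNReal.ofReal ρ) := ⟨by simpa using hρ⟩
  have h1 : MemLp (fun _ : α => (1 : ℝ)) (ENNReal.ofReal ρ) ν := memLp_const 1
  have key : ∀ z : ℝ, ∫⁻ u, edist (f u) z ^ ρ ∂ν =
      ENNReal.ofReal ‖hf.toLp f - z • h1.toLp _‖ ^ ρ := by
    intro z
    rw [lintegral_edist_rpow_eq f hρ, ← MemLp.toLp_const_smul, ← MemLp.toLp_sub, Lp.norm_toLp,
      ENNReal.ofReal_toReal (hf.sub (h1.const_smul z)).2.ne]
    congr 2
    ext u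
    simp
  have he : h1.toLp (fun _ : α => (1 : ℝ)) ≠ 0 := by
    intro h
    have h2 := h1.coeFn_toLp
    rw [h] at h2
    have h3 : ∀ᵐ _u ∂ν, False := by
      filter_upwards [h2, Lp.coeFn_zero ℝ (ENNReal.ofReal ρ) ν] with u hu hu'
      rw [hu'] at hu
      simp at hu
    exact hν (ae_eq_bot.1 (eventually_false_iff_eq_bot.1 h3))
  obtain ⟨y, hy⟩ := exists_forall_norm_sub_smul_le (hf.toLp f) (h1.toLp _) he
  refine ⟨y, fun z => ?_⟩
  rw [key, key]
  exact ENNReal.rpow_le_rpow (ENNReal.ofReal_le_ofReal (hy z)) (by linarith)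

section Optimal

variable {μ : Measure ℝ} [IsProbabilityMeasure μ] {ρ : ℝ} {N : ℕ} {x : ℕ → ℝ}

theorem minError_le (hρ : 1 ≤ ρ) (hN : 1 ≤ N) (x : ℕ → ℝ) :
    minError μ ρ N ≤ gridCost μ ρ N x ^ (1 / ρ) := by
  obtain ⟨y, hy, hyx⟩ := exists_monotoneOn_empirical_eq N x
  refine (iInf₂_le y hy).trans ?_
  rw [wasserstein_eq, hyx]
  exact ENNReal.rpow_le_rpow (transportCost_le_gridCost μ ρ hN x) (by positivity)

theorem IsOptimalGrid.minError_eq (hρ : 1 ≤ ρ) (hμ : Integrable (fun x : ℝ => |x| ^ ρ) μ)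
    (hN : 1 ≤ N) (hx : IsOptimalGrid μ ρ N x) :
    minError μ ρ N = gridCost μ ρ N x ^ (1 / ρ) := by
  rw [← hx.2, wasserstein_eq, transportCost_eq_gridCost μ hρ hμ hN hx.1]

theorem IsOptimalGrid.gridCost_le (hρ : 1 ≤ ρ) (hμ : Integrable (fun x : ℝ => |x| ^ ρ) μ)
    (hN : 1 ≤ N) (hx : IsOptimalGrid μ ρ N x) (z : ℕ → ℝ) :
    gridCost μ ρ N x ≤ gridCost μ ρ N z := by
  have h := minError_le (μ := μ) hρ hN z
  rwa [hx.minError_eq hρ hμ hN, ENNReal.rpow_le_rpow_iff (by positivity)] at h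

theorem lintegral_cell_lt_top (hρ : 1 ≤ ρ) (hμ : Integrable (fun x : ℝ => |x| ^ ρ) μ)
    {i : ℕ} (hi : i ∈ Finset.Icc 1 N) (y : ℝ) :
    ∫⁻ u, edist (quantile μ u) y ^ ρ ∂(cell N i) < ⊤ := by
  refine (lintegral_mono' (cell_le hi) le_rfl).trans_lt ?_
  rw [lintegral_edist_rpow_eq _ hρ]
  exact ENNReal.rpow_lt_top_of_nonneg (by linarith)
    ((memLp_quantile μ hρ hμ).sub (memLp_const y)).2.ne

theorem gridCost_lt_top (hρ : 1 ≤ ρ) (hμ : Integrable (fun x : ℝ => |x| ^ ρ) μ) (x : ℕ → ℝ) :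
    gridCost μ ρ N x < ⊤ :=
  ENNReal.sum_lt_top.2 fun _ hi => lintegral_cell_lt_top hρ hμ hi _

/-- Each cell is minimised separately and the minimisers are then sorted, so no monotonicity of the
minimisers has to be proved. -/
theorem exists_isOptimalGrid (hρ : 1 ≤ ρ) (hμ : Integrable (fun x : ℝ => |x| ^ ρ) μ)
    (hN : 1 ≤ N) : ∃ x : ℕ → ℝ, IsOptimalGrid μ ρ N x := by
  have hex : ∀ i : ℕ, ∃ y : ℝ, i ∈ Finset.Icc 1 N → ∀ z : ℝ,
      ∫⁻ u, edist (quantile μ u) y ^ ρ ∂(cell N i) ≤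
        ∫⁻ u, edist (quantile μ u) z ^ ρ ∂(cell N i) := by
    intro i
    by_cases hi : i ∈ Finset.Icc 1 N
    · have : IsFiniteMeasure (cell N i) := ⟨by rw [cell_univ hN]; simp; omega⟩
      have h0 : cell N i ≠ 0 := fun h => by
        have := cell_univ hN i
        rw [h, Measure.coe_zero, Pi.zero_apply] at this
        exact ENNReal.inv_ne_zero.2 (ENNReal.natCast_ne_top N) this.symm
      obtain ⟨y, hy⟩ := exists_forall_lintegral_edist_le h0 hρ
        ((memLp_quantile μ hρ hμ).mono_measure (cell_le hi))
      exact ⟨y, fun _ => hy⟩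
    · exact ⟨0, fun h => absurd h hi⟩
  choose y hy using hex
  obtain ⟨x, hx, hxy⟩ := exists_monotoneOn_empirical_eq N y
  refine ⟨x, hx, le_antisymm (le_iInf₂ fun z hz => ?_) (iInf₂_le x hx)⟩
  rw [wasserstein_eq, wasserstein_eq, transportCost_eq_gridCost μ hρ hμ hN hz, hxy]
  refine ENNReal.rpow_le_rpow ((transportCost_le_gridCost μ ρ hN y).trans ?_) (by positivity)
  exact Finset.sum_le_sum fun i hi => hy i hi (z i)

/-- Every point of an optimal grid minimises the error on its own cell. -/
theorem IsOptimalGrid.lintegral_cell_le (hρ : 1 ≤ ρ) (hμ : Integrable (fun x : ℝ => |x| ^ ρ) μ)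
    (hN : 1 ≤ N) (hx : IsOptimalGrid μ ρ N x) {i : ℕ} (hi : i ∈ Finset.Icc 1 N) (y : ℝ) :
    ∫⁻ u, edist (quantile μ u) (x i) ^ ρ ∂(cell N i) ≤
      ∫⁻ u, edist (quantile μ u) y ^ ρ ∂(cell N i) := by
  have h := hx.gridCost_le hρ hμ hN (Function.update x i y)
  have hfin := (gridCost_lt_top (N := N) hρ hμ x).ne
  rw [gridCost, ← Finset.add_sum_erase _ _ hi] at h hfin
  rw [gridCost, ← Finset.add_sum_erase _ _ hi, Function.update_self] at h
  rw [Finset.sum_congr (f := fun j => ∫⁻ u, edist (quantile μ u) (Function.update x i y j) ^ ρ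
    ∂(cell N j)) (g := fun j => ∫⁻ u, edist (quantile μ u) (x j) ^ ρ ∂(cell N j)) rfl
    fun j hj => by rw [Function.update_of_ne (Finset.ne_of_mem_erase hj)]] at h
  -- The common error of the other cells is finite, hence cancels.
  exact (ENNReal.add_le_add_iff_right (ENNReal.add_ne_top.1 hfin).2).1 h

end Optimal

/-! ### Monotone functions on the unit interval -/

/-- The image of the graph of `f` under the point reflection exchanging the two ends of the unit
interval. -/
def reflect (f : ℝ → ℝ) (u : ℝ) : ℝ := -f (1 - u)

theorem _root_.MonotoneOn.reflect {f : ℝ → ℝ} (hf : MonotoneOn f (Ioo 0 1)) :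
    MonotoneOn (reflect f) (Ioo 0 1) := fun u hu v hv huv =>
  neg_le_neg (hf ⟨by linarith [hv.2], by linarith [hv.1]⟩ ⟨by linarith [hu.2], by linarith [hu.1]⟩
    (by linarith))

theorem setLIntegral_reflect (f : ℝ → ℝ) (ρ a y : ℝ) :
    ∫⁻ u in Ioo (1 - a) 1, edist (f u) y ^ ρ = ∫⁻ u in Ioo 0 a, edist (reflect f u) (-y) ^ ρ := by
  have hmp : MeasurePreserving (fun u : ℝ => 1 - u) := volume.measurePreserving_sub_left 1
  have hemb : MeasurableEmbedding (fun u : ℝ => 1 - u) :=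
    (Homeomorph.subLeft (1 : ℝ)).measurableEmbedding
  rw [← hmp.setLIntegral_comp_preimage_emb hemb]
  have hpre : (fun u : ℝ => 1 - u) ⁻¹' Ioo (1 - a) 1 = Ioo 0 a := by
    rw [preimage_const_sub_Ioo]; simp
  rw [hpre]
  simp only [reflect, edist_dist, Real.dist_eq]
  refine lintegral_congr fun u => ?_
  rw [← abs_neg]
  ring_nf

/-! ### Cell errors, halving increments and logarithmic growth -/

theorem ofReal_div_le_setLIntegral {f : ℝ → ℝ} {ρ : ℝ} (hρ : 0 ≤ ρ) {a b y d : ℝ} (hd : 0 ≤ d)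
    (h : ∀ u ∈ Ioo a b, d ≤ |f u - y|) :
    ENNReal.ofReal (d ^ ρ * (b - a)) ≤ ∫⁻ u in Ioo a b, edist (f u) y ^ ρ := by
  rw [ENNReal.ofReal_mul (by positivity), ← Real.volume_Ioo, ← setLIntegral_const]
  refine setLIntegral_mono' measurableSet_Ioo fun u hu => ?_
  rw [edist_rpow_eq_ofReal hρ]
  exact ENNReal.ofReal_le_ofReal (Real.rpow_le_rpow hd (h u hu) hρ)

/-- If `y` lies below the midpoint of the two values of `f`, it is at distance at least `d` from `f`
on `(1/(2n), 1/n)`; otherwise it is so on `(0, 1/(8n))`. The shorter of these intervals gives the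
factor 8. -/
theorem sub_le_of_setLIntegral_le {f : ℝ → ℝ} (hf : MonotoneOn f (Ioo 0 1)) {ρ : ℝ} (hρ : 1 ≤ ρ)
    {n : ℕ} (hn : 1 ≤ n) {y K : ℝ} (hK : 0 ≤ K)
    (h : (n : ℝ≥0∞) * ∫⁻ u in Ioo 0 (1 / (n : ℝ)), edist (f u) y ^ ρ ≤ ENNReal.ofReal K) :
    f (1 / (2 * n)) - f (1 / (8 * n)) ≤ 2 * (8 * K) ^ (1 / ρ) := by
  have hn1 : (1 : ℝ) ≤ n := by exact_mod_cast hn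
  have hn0 : (0 : ℝ) < n := by linarith
  have mem2 : 1 / (2 * (n : ℝ)) ∈ Ioo (0 : ℝ) 1 :=
    ⟨by positivity, by rw [div_lt_one (by positivity)]; linarith⟩
  have mem8 : 1 / (8 * (n : ℝ)) ∈ Ioo (0 : ℝ) 1 :=
    ⟨by positivity, by rw [div_lt_one (by positivity)]; linarith⟩
  have hlen : 1 / (n : ℝ) ≤ 1 := by rw [div_le_one hn0]; exact hn1
  set d := (f (1 / (2 * n)) - f (1 / (8 * n))) / 2 with hd
  have hd0 : 0 ≤ d := div_nonneg (sub_nonneg.2 (hf mem8 mem2 (by gcongr; norm_num))) two_pos.le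
  have hle : ENNReal.ofReal (d ^ ρ * (1 / (8 * n))) ≤
      ∫⁻ u in Ioo 0 (1 / (n : ℝ)), edist (f u) y ^ ρ := by
    rcases le_total y ((f (1 / (2 * n)) + f (1 / (8 * n))) / 2) with hy | hy
    · have h1 := ofReal_div_le_setLIntegral (f := f) (ρ := ρ) (by linarith) (a := 1 / (2 * n))
        (b := 1 / (n : ℝ)) (y := y) hd0 fun u hu => by
          have := hf mem2 ⟨mem2.1.trans hu.1, hu.2.trans_le hlen⟩ hu.1.le
          exact le_trans (by linarith) (le_abs_self _)
      refine (ENNReal.ofReal_le_ofReal ?_).trans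
        (h1.trans (lintegral_mono_set (Ioo_subset_Ioo_left mem2.1.le)))
      gcongr
      have : 1 / (n : ℝ) - 1 / (2 * n) = 4 * (1 / (8 * n)) := by field_simp; norm_num
      rw [this]
      linarith [mem8.1]
    · have h1 := ofReal_div_le_setLIntegral (f := f) (ρ := ρ) (by linarith) (a := 0)
        (b := 1 / (8 * (n : ℝ))) (y := y) hd0 fun u hu => by
          have := hf ⟨hu.1, hu.2.trans mem8.2⟩ mem8 hu.2.le
          exact le_trans (by linarith) (neg_le_abs _)
      rw [sub_zero] at h1
      refine h1.trans (lintegral_mono_set (Ioo_subset_Ioo_right ?_))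
      gcongr
      linarith
  have h2 : (n : ℝ≥0∞) * ENNReal.ofReal (d ^ ρ * (1 / (8 * n))) ≤ ENNReal.ofReal K :=
    (mul_le_mul_right hle _).trans h
  rw [← ENNReal.ofReal_natCast, ← ENNReal.ofReal_mul hn0.le, ENNReal.ofReal_le_ofReal_iff hK] at h2
  have h3 : d ^ ρ ≤ 8 * K := by
    have : (n : ℝ) * (d ^ ρ * (1 / (8 * n))) = d ^ ρ / 8 := by field_simp
    linarith
  have h4 : d ≤ (8 * K) ^ (1 / ρ) := by
    have := Real.rpow_le_rpow (by positivity) h3 (show 0 ≤ 1 / ρ by positivity)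
    rwa [← Real.rpow_mul hd0, mul_one_div_cancel (by linarith), Real.rpow_one] at this
  linarith

theorem sub_half_le {f : ℝ → ℝ} (hf : MonotoneOn f (Ioo 0 1)) {C : ℝ}
    (h : ∀ n : ℕ, 1 ≤ n → f (1 / (2 * n)) - f (1 / (8 * n)) ≤ C) {u : ℝ} (hu : u ∈ Ioc 0 (1 / 2)) :
    f u - f (u / 2) ≤ C := by
  obtain ⟨hu0, hu1⟩ := hu
  -- This choice gives `1/(8n) ≤ u/2 < u ≤ 1/(2n)`, by `1/(2u) < n + 1 ≤ 2n`.
  set n := ⌊1 / (2 * u)⌋₊ with hn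
  have h1 : (1 : ℝ) ≤ 1 / (2 * u) := by rw [le_div_iff₀ (by positivity)]; linarith
  have hn1 : 1 ≤ n := Nat.le_floor (by simpa using h1)
  have hnr : (1 : ℝ) ≤ n := by exact_mod_cast hn1
  have hle : (n : ℝ) ≤ 1 / (2 * u) := Nat.floor_le (by positivity)
  have hlt : 1 / (2 * u) < n + 1 := Nat.lt_floor_add_one _
  rw [le_div_iff₀ (by positivity)] at hle
  rw [div_lt_iff₀ (by positivity)] at hlt
  have m2 : 1 / (2 * (n : ℝ)) ∈ Ioo (0 : ℝ) 1 :=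
    ⟨by positivity, by rw [div_lt_one (by positivity)]; linarith⟩
  have m8 : 1 / (8 * (n : ℝ)) ∈ Ioo (0 : ℝ) 1 :=
    ⟨by positivity, by rw [div_lt_one (by positivity)]; linarith⟩
  have e1 : f u ≤ f (1 / (2 * n)) := by
    refine hf ⟨hu0, by linarith⟩ m2 ?_
    rw [le_div_iff₀ (by positivity)]; linarith
  have e2 : f (1 / (8 * n)) ≤ f (u / 2) := by
    refine hf m8 ⟨by linarith, by linarith⟩ ?_
    rw [div_le_iff₀ (by positivity)]; nlinarith
  linarith [h n hn1]

theorem sub_le_log_of_sub_half_le {f : ℝ → ℝ} (hf : MonotoneOn f (Ioo 0 1)) {C : ℝ} (hC : 0 ≤ C)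
    (h : ∀ u ∈ Ioc (0 : ℝ) (1 / 2), f u - f (u / 2) ≤ C) {u v : ℝ} (hu : 0 < u) (huv : u ≤ v)
    (hv : v ≤ 1 / 2) : f v - f u ≤ C * (1 + Real.log (v / u) / Real.log 2) := by
  have hv0 : 0 < v := hu.trans_le huv
  have step : ∀ k : ℕ, f v - f (v / 2 ^ k) ≤ k * C := by
    intro k
    induction k with
    | zero => simp
    | succ k ih =>
      have := h (v / 2 ^ k) ⟨by positivity, (div_le_self hv0.le (one_le_pow₀ (by norm_num))).trans hv⟩
      rw [div_div, ← pow_succ] at this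
      push_cast
      linarith
  have hl2 : 0 < Real.log 2 := Real.log_pos (by norm_num)
  have hl : 0 ≤ Real.log (v / u) := Real.log_nonneg ((one_le_div hu).2 huv)
  -- The number of halvings needed to bring `v` down to at most `u`.
  set k := ⌈Real.log (v / u) / Real.log 2⌉₊ with hk
  have h1 : Real.log (v / u) / Real.log 2 ≤ k := Nat.le_ceil _
  have h2 : (k : ℝ) < Real.log (v / u) / Real.log 2 + 1 := Nat.ceil_lt_add_one (by positivity)
  have h3 : v / 2 ^ k ≤ u := by
    rw [div_le_iff₀ hl2, ← Real.log_pow] at h1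
    have := (Real.log_le_log_iff (by positivity) (by positivity)).1 h1
    rw [div_le_iff₀ hu] at this
    rw [div_le_iff₀ (by positivity)]
    linarith
  have h4 : f (v / 2 ^ k) ≤ f u :=
    hf ⟨by positivity, by linarith⟩ ⟨hu, by linarith⟩ h3
  have h5 : (k : ℝ) * C ≤ C * (1 + Real.log (v / u) / Real.log 2) := by
    rw [mul_comm]; gcongr; linarith
  linarith [step k]

theorem setLIntegral_rpow_neg_half {a : ℝ} (ha : 0 ≤ a) :
    ∫⁻ u in Ioo 0 a, ENNReal.ofReal (u ^ (-(1 / 2) : ℝ)) = ENNReal.ofReal (2 * a ^ (1 / 2 : ℝ)) := by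
  have hi : IntervalIntegrable (fun u : ℝ => u ^ (-(1 / 2) : ℝ)) volume 0 a :=
    intervalIntegral.intervalIntegrable_rpow' (by norm_num)
  rw [restrict_Ioo_eq_restrict_Ioc, ← ofReal_integral_eq_lintegral_ofReal, ←
    intervalIntegral.integral_of_le ha, integral_rpow (Or.inl (by norm_num))]
  · congr 1
    norm_num
    ring
  · exact (intervalIntegrable_iff_integrableOn_Ioc_of_le ha).1 hi
  · filter_upwards [ae_restrict_mem measurableSet_Ioc] with u hu
    exact Real.rpow_nonneg hu.1.le _

/-- The logarithm is compared with the power `1/(2ρ)`, so that the `ρ`-th power is at most a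
multiple of `w^(-1/2)`, which is integrable at 0. -/
theorem one_add_log_rpow_le {ρ w : ℝ} (hρ : 1 ≤ ρ) (hw : 0 < w) (hw1 : w ≤ 1) :
    (1 + Real.log (1 / w)) ^ ρ ≤ (1 + 2 * ρ) ^ ρ * w ^ (-(1 / 2) : ℝ) := by
  have hw' : 1 ≤ 1 / w := (one_le_div hw).2 hw1
  have h1 := Real.log_le_rpow_div (x := 1 / w) (by positivity) (show 0 < 1 / (2 * ρ) by positivity)
  have h2 : 1 ≤ (1 / w) ^ (1 / (2 * ρ)) := Real.one_le_rpow hw' (by positivity)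
  have h3 : 1 + Real.log (1 / w) ≤ (1 + 2 * ρ) * (1 / w) ^ (1 / (2 * ρ)) := by
    have : (1 / w) ^ (1 / (2 * ρ)) / (1 / (2 * ρ)) = 2 * ρ * (1 / w) ^ (1 / (2 * ρ)) := by
      field_simp
    linarith
  have h4 : 0 ≤ Real.log (1 / w) := Real.log_nonneg hw'
  refine (Real.rpow_le_rpow (by linarith) h3 (by linarith)).trans_eq ?_
  rw [Real.mul_rpow (by positivity) (by positivity), ← Real.rpow_mul (by positivity), one_div w,
    Real.inv_rpow hw.le, Real.rpow_neg hw.le]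
  congr 3
  field_simp

theorem natCast_mul_setLIntegral_le {f : ℝ → ℝ} {ρ : ℝ} (hρ : 1 ≤ ρ) {n : ℕ} (hn : 1 ≤ n)
    {A y : ℝ} (hA : 0 ≤ A)
    (h : ∀ u ∈ Ioo 0 (1 / (n : ℝ)), |f u - y| ≤ A * (1 + Real.log (1 / (n * u)))) :
    (n : ℝ≥0∞) * ∫⁻ u in Ioo 0 (1 / (n : ℝ)), edist (f u) y ^ ρ ≤
      ENNReal.ofReal (2 * (A * (1 + 2 * ρ)) ^ ρ) := by
  have hn0 : (0 : ℝ) < n := by exact_mod_cast hn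
  have hpt : ∀ u ∈ Ioo 0 (1 / (n : ℝ)), edist (f u) y ^ ρ ≤
      ENNReal.ofReal ((A * (1 + 2 * ρ)) ^ ρ * (n : ℝ) ^ (-(1 / 2) : ℝ)) *
        ENNReal.ofReal (u ^ (-(1 / 2) : ℝ)) := by
    intro u hu
    have hu0 := hu.1
    have hnu : (n : ℝ) * u ≤ 1 := by
      have := hu.2.le
      rw [le_div_iff₀ hn0] at this
      linarith
    rw [edist_rpow_eq_ofReal (by linarith), ← ENNReal.ofReal_mul (by positivity)]
    refine ENNReal.ofReal_le_ofReal ?_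
    have hlog : 0 ≤ Real.log (1 / (n * u)) :=
      Real.log_nonneg ((one_le_div (by positivity)).2 hnu)
    calc |f u - y| ^ ρ ≤ (A * (1 + Real.log (1 / (n * u)))) ^ ρ :=
          Real.rpow_le_rpow (abs_nonneg _) (h u hu) (by linarith)
      _ = A ^ ρ * (1 + Real.log (1 / (n * u))) ^ ρ := Real.mul_rpow hA (by linarith)
      _ ≤ A ^ ρ * ((1 + 2 * ρ) ^ ρ * (n * u) ^ (-(1 / 2) : ℝ)) := by
          gcongr
          exact one_add_log_rpow_le hρ (by positivity) hnu
      _ = _ := by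
          rw [Real.mul_rpow hA (by linarith), Real.mul_rpow hn0.le hu0.le]
          ring
  refine (mul_le_mul_right (setLIntegral_mono' measurableSet_Ioo hpt) _).trans_eq ?_
  rw [lintegral_const_mul' _ _ ENNReal.ofReal_ne_top, setLIntegral_rpow_neg_half (by positivity),
    ← ENNReal.ofReal_natCast, ← ENNReal.ofReal_mul (by positivity),
    ← ENNReal.ofReal_mul (by positivity)]
  congr 1
  -- Scale invariance: the powers of `n` cancel, leaving a bound uniform in `n`.
  have e : (n : ℝ) * ((n : ℝ) ^ (-(1 / 2) : ℝ) * (1 / (n : ℝ)) ^ (1 / 2 : ℝ)) = 1 := by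
    rw [one_div (n : ℝ), Real.inv_rpow hn0.le, ← Real.rpow_neg hn0.le, ← Real.rpow_add hn0]
    norm_num
    rw [Real.rpow_neg_one]
    exact mul_inv_cancel₀ hn0.ne'
  linear_combination (2 * (A * (1 + 2 * ρ)) ^ ρ) * e

/-! ### The extreme cells -/

theorem cellError_first (μ : Measure ℝ) (ρ y : ℝ) (N : ℕ) :
    cellError μ ρ 0 (1 / (N : ℝ)) y = ∫⁻ u, edist (quantile μ u) y ^ ρ ∂(cell N 1) := by
  rw [← cellError_cell]
  simp

theorem cellError_last (μ : Measure ℝ) (ρ y : ℝ) {N : ℕ} (hN : 1 ≤ N) :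
    cellError μ ρ (((N : ℝ) - 1) / (N : ℝ)) 1 y =
      ∫⁻ u, edist (quantile μ u) y ^ ρ ∂(cell N N) := by
  have hN' : (N : ℝ) ≠ 0 := by exact_mod_cast (by omega : N ≠ 0)
  rw [← cellError_cell, div_self hN']

theorem lintegral_cell_one (f : ℝ → ℝ) (ρ y : ℝ) (N : ℕ) :
    ∫⁻ u, edist (f u) y ^ ρ ∂(cell N 1) = ∫⁻ u in Ioo 0 (1 / (N : ℝ)), edist (f u) y ^ ρ := by
  simp [cell]

theorem lintegral_cell_self (f : ℝ → ℝ) (ρ y : ℝ) {N : ℕ} (hN : 1 ≤ N) :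
    ∫⁻ u, edist (f u) y ^ ρ ∂(cell N N) =
      ∫⁻ u in Ioo 0 (1 / (N : ℝ)), edist (reflect f u) (-y) ^ ρ := by
  have hN' : (N : ℝ) ≠ 0 := by exact_mod_cast (by omega : N ≠ 0)
  rw [← setLIntegral_reflect, cell, div_self hN', sub_div, div_self hN']

/-- The total error on the first and the last cell, for the grid points `y` and `z`. -/
noncomputable def extremeCost (μ : Measure ℝ) (ρ : ℝ) (N : ℕ) (y z : ℝ) : ℝ≥0∞ :=
  cellError μ ρ 0 (1 / (N : ℝ)) y + cellError μ ρ (((N : ℝ) - 1) / (N : ℝ)) 1 z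

theorem bddAbove_image_iff_exists_nonneg {f : ℝ → ℝ} {s : Set ℝ} :
    BddAbove (f '' s) ↔ ∃ C, 0 ≤ C ∧ ∀ u ∈ s, f u ≤ C := by
  refine ⟨fun ⟨C, hC⟩ => ⟨max C 0, le_max_right _ _, fun u hu =>
    (hC (mem_image_of_mem f hu)).trans (le_max_left _ _)⟩, fun ⟨C, _, hC⟩ => ⟨C, ?_⟩⟩
  rintro _ ⟨u, hu, rfl⟩
  exact hC u hu

/-- Both increments are nonnegative, so bounding their sum amounts to bounding each; the right one
becomes a left one after reflection. -/
theorem bddAbove_halving_iff (μ : Measure ℝ) :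
    BddAbove ((fun u : ℝ => quantile μ (1 - u / 2) - quantile μ (1 - u) + quantile μ u -
      quantile μ (u / 2)) '' Ioc 0 (1 / 2)) ↔
    ∃ C, 0 ≤ C ∧ (∀ u ∈ Ioc (0 : ℝ) (1 / 2), quantile μ u - quantile μ (u / 2) ≤ C) ∧
      ∀ u ∈ Ioc (0 : ℝ) (1 / 2), reflect (quantile μ) u - reflect (quantile μ) (u / 2) ≤ C := by
  rw [bddAbove_image_iff_exists_nonneg]
  have hQ := monotoneOn_quantile μ
  have h1 : ∀ u ∈ Ioc (0 : ℝ) (1 / 2), quantile μ (u / 2) ≤ quantile μ u := fun u hu =>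
    hQ ⟨by linarith [hu.1], by linarith [hu.2]⟩ ⟨hu.1, by linarith [hu.2]⟩ (by linarith [hu.1])
  have h2 : ∀ u ∈ Ioc (0 : ℝ) (1 / 2), quantile μ (1 - u) ≤ quantile μ (1 - u / 2) := fun u hu =>
    hQ ⟨by linarith [hu.2], by linarith [hu.1]⟩ ⟨by linarith [hu.2], by linarith [hu.1]⟩
      (by linarith [hu.1])
  constructor
  · rintro ⟨C, hC, h⟩
    refine ⟨C, hC, fun u hu => ?_, fun u hu => ?_⟩
    · linarith [h u hu, h2 u hu]
    · simp only [reflect]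
      linarith [h u hu, h1 u hu]
  · rintro ⟨C, hC, h, h'⟩
    refine ⟨C + C, by linarith, fun u hu => ?_⟩
    have := h' u hu
    simp only [reflect] at this
    linarith [h u hu]

theorem natCast_mul_setLIntegral_le_of_sub_half_le {f : ℝ → ℝ} (hf : MonotoneOn f (Ioo 0 1))
    {ρ C : ℝ} (hρ : 1 ≤ ρ) (hC : 0 ≤ C) (h : ∀ u ∈ Ioc (0 : ℝ) (1 / 2), f u - f (u / 2) ≤ C)
    {N : ℕ} (hN : 2 ≤ N) :
    (N : ℝ≥0∞) * ∫⁻ u in Ioo 0 (1 / (N : ℝ)), edist (f u) (f (1 / N)) ^ ρ ≤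
      ENNReal.ofReal (2 * (C / Real.log 2 * (1 + 2 * ρ)) ^ ρ) := by
  have hN2 : (2 : ℝ) ≤ N := by exact_mod_cast hN
  have hl2 : 0 < Real.log 2 := Real.log_pos (by norm_num)
  have hl1 : Real.log 2 ≤ 1 := by linarith [Real.log_two_lt_d9]
  have hle : 1 / (N : ℝ) ≤ 1 / 2 := by gcongr
  refine natCast_mul_setLIntegral_le hρ (by omega) (by positivity) fun u hu => ?_
  have h1 := sub_le_log_of_sub_half_le hf hC h hu.1 hu.2.le hle
  have h2 : f u ≤ f (1 / N) :=
    hf ⟨hu.1, by linarith [hu.2]⟩ ⟨by positivity, by linarith⟩ hu.2.le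
  rw [abs_sub_comm, abs_of_nonneg (by linarith)]
  refine h1.trans ?_
  rw [div_div]
  have : C / Real.log 2 * (1 + Real.log (1 / (N * u))) =
    C * (1 / Real.log 2 + Real.log (1 / (N * u)) / Real.log 2) := by ring
  rw [this]
  gcongr
  rwa [one_le_div hl2]

section Extreme

variable {μ : Measure ℝ} {ρ : ℝ}

theorem natCast_mul_gridCost_eq (hρ : 1 ≤ ρ) (N : ℕ) (x : ℕ → ℝ) :
    (N : ℝ≥0∞) * gridCost μ ρ N x =
      (ENNReal.ofReal ((N : ℝ) ^ (1 / ρ)) * gridCost μ ρ N x ^ (1 / ρ)) ^ ρ := by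
  have hρ0 : ρ ≠ 0 := by linarith
  rw [ENNReal.mul_rpow_of_nonneg _ _ (by linarith), ← ENNReal.rpow_mul, one_div_mul_cancel hρ0,
    ENNReal.rpow_one, ENNReal.ofReal_rpow_of_nonneg (by positivity) (by linarith),
    ← Real.rpow_mul (by positivity), one_div_mul_cancel hρ0, Real.rpow_one, ENNReal.ofReal_natCast]

/-- Any choice of points with this error bound suffices; optimality enters only in the converse. -/
theorem bddAbove_halving_of_iSup_extremeCost (hρ : 1 ≤ ρ) {x : ℕ → ℕ → ℝ}
    (h : (⨆ (N : ℕ) (_ : 1 ≤ N), (N : ℝ≥0∞) * extremeCost μ ρ N (x N 1) (x N N)) < ⊤) :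
    BddAbove ((fun u : ℝ => quantile μ (1 - u / 2) - quantile μ (1 - u) + quantile μ u -
      quantile μ (u / 2)) '' Ioc 0 (1 / 2)) := by
  set S := ⨆ (N : ℕ) (_ : 1 ≤ N), (N : ℝ≥0∞) * extremeCost μ ρ N (x N 1) (x N N) with hS
  have hle : ∀ N : ℕ, 1 ≤ N →
      (N : ℝ≥0∞) * extremeCost μ ρ N (x N 1) (x N N) ≤ ENNReal.ofReal S.toReal := fun N hN => by
    rw [ENNReal.ofReal_toReal h.ne]
    exact le_iSup₂ (f := fun (N : ℕ) (_ : 1 ≤ N) =>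
      (N : ℝ≥0∞) * extremeCost μ ρ N (x N 1) (x N N)) N hN
  rw [bddAbove_halving_iff]
  have hS0 : 0 ≤ S.toReal := ENNReal.toReal_nonneg
  refine ⟨2 * (8 * S.toReal) ^ (1 / ρ), by positivity, fun u hu => ?_, fun u hu => ?_⟩
  · refine sub_half_le (monotoneOn_quantile μ) (fun N hN => ?_) hu
    refine sub_le_of_setLIntegral_le (monotoneOn_quantile μ) hρ hN (y := x N 1) hS0 ?_
    refine le_trans (mul_le_mul_right ?_ _) (hle N hN)
    exact le_self_add
  · refine sub_half_le (monotoneOn_quantile μ).reflect (fun N hN => ?_) hu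
    refine sub_le_of_setLIntegral_le (monotoneOn_quantile μ).reflect hρ hN (y := -x N N) hS0 ?_
    refine le_trans (mul_le_mul_right ?_ _) (hle N hN)
    rw [← lintegral_cell_self _ _ _ hN, ← cellError_last _ _ _ hN]
    exact le_add_self

variable [IsProbabilityMeasure μ]

theorem iSup_extremeCost_lt_top_of_minError (hρ : 1 ≤ ρ)
    (hμ : Integrable (fun x : ℝ => |x| ^ ρ) μ) {x : ℕ → ℕ → ℝ}
    (hx : ∀ N, 1 ≤ N → IsOptimalGrid μ ρ N (x N))
    (h : (⨆ (N : ℕ) (_ : 1 ≤ N), ENNReal.ofReal ((N : ℝ) ^ (1 / ρ)) * minError μ ρ N) < ⊤) :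
    (⨆ (N : ℕ) (_ : 1 ≤ N), (N : ℝ≥0∞) * extremeCost μ ρ N (x N 1) (x N N)) < ⊤ := by
  set S := ⨆ (N : ℕ) (_ : 1 ≤ N), ENNReal.ofReal ((N : ℝ) ^ (1 / ρ)) * minError μ ρ N with hS
  refine lt_of_le_of_lt (iSup₂_le fun N hN => ?_)
    (ENNReal.add_lt_top.2 ⟨ENNReal.rpow_lt_top_of_nonneg (y := ρ) (by linarith) h.ne,
      ENNReal.rpow_lt_top_of_nonneg (y := ρ) (by linarith) h.ne⟩)
  have hg : (N : ℝ≥0∞) * gridCost μ ρ N (x N) ≤ S ^ ρ := by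
    rw [natCast_mul_gridCost_eq hρ, ← (hx N hN).minError_eq hρ hμ hN]
    exact ENNReal.rpow_le_rpow (le_iSup₂ (f := fun (N : ℕ) (_ : 1 ≤ N) =>
      ENNReal.ofReal ((N : ℝ) ^ (1 / ρ)) * minError μ ρ N) N hN) (by linarith)
  have hc : ∀ i ∈ Finset.Icc 1 N,
      ∫⁻ u, edist (quantile μ u) (x N i) ^ ρ ∂(cell N i) ≤ gridCost μ ρ N (x N) := fun i hi =>
    Finset.single_le_sum (f := fun i => ∫⁻ u, edist (quantile μ u) (x N i) ^ ρ ∂(cell N i))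
      (fun _ _ => zero_le) hi
  rw [extremeCost, cellError_first, cellError_last _ _ _ hN, mul_add]
  exact add_le_add ((mul_le_mul_right (hc 1 (by simp [hN])) _).trans hg)
    ((mul_le_mul_right (hc N (by simp [hN])) _).trans hg)

theorem iSup_extremeCost_lt_top_of_bddAbove_halving (hρ : 1 ≤ ρ)
    (hμ : Integrable (fun x : ℝ => |x| ^ ρ) μ) {x : ℕ → ℕ → ℝ}
    (hx : ∀ N, 1 ≤ N → IsOptimalGrid μ ρ N (x N))
    (h : BddAbove ((fun u : ℝ => quantile μ (1 - u / 2) - quantile μ (1 - u) + quantile μ u -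
      quantile μ (u / 2)) '' Ioc 0 (1 / 2))) :
    (⨆ (N : ℕ) (_ : 1 ≤ N), (N : ℝ≥0∞) * extremeCost μ ρ N (x N 1) (x N N)) < ⊤ := by
  obtain ⟨C, hC, h1, h2⟩ := (bddAbove_halving_iff μ).1 h
  set B := ENNReal.ofReal (2 * (C / Real.log 2 * (1 + 2 * ρ)) ^ ρ) with hB
  have hone : extremeCost μ ρ 1 (x 1 1) (x 1 1) < ⊤ := by
    rw [extremeCost, cellError_first, cellError_last _ _ _ le_rfl]
    exact ENNReal.add_lt_top.2 ⟨lintegral_cell_lt_top hρ hμ (by simp) _,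
      lintegral_cell_lt_top hρ hμ (by simp) _⟩
  refine lt_of_le_of_lt (b := extremeCost μ ρ 1 (x 1 1) (x 1 1) + (B + B))
    (iSup₂_le fun N hN => ?_)
    (ENNReal.add_lt_top.2 ⟨hone, ENNReal.add_lt_top.2 ⟨ENNReal.ofReal_lt_top,
      ENNReal.ofReal_lt_top⟩⟩)
  -- For `N = 1` the test quantiles at `1/N` and `1 - 1/N` would sit at the ends of the unit
  -- interval; the finite moment handles this case.
  rcases hN.eq_or_lt with rfl | hN2
  · rw [Nat.cast_one, one_mul]
    exact le_self_add
  · refine le_trans ?_ le_add_self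
    have hQ := monotoneOn_quantile μ
    rw [extremeCost, cellError_first, cellError_last _ _ _ hN, mul_add]
    refine add_le_add ?_ ?_
    · refine (mul_le_mul_right ((hx N hN).lintegral_cell_le hρ hμ hN (by simp [hN])
        (quantile μ (1 / N))) _).trans ?_
      rw [lintegral_cell_one]
      exact natCast_mul_setLIntegral_le_of_sub_half_le hQ hρ hC h1 hN2
    · refine (mul_le_mul_right ((hx N hN).lintegral_cell_le hρ hμ hN (by simp [hN])
        (quantile μ (1 - 1 / N))) _).trans ?_
      rw [lintegral_cell_self _ _ _ hN]
      exact natCast_mul_setLIntegral_le_of_sub_half_le hQ.reflect hρ hC h2 hN2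

end Extreme

/-! ### Logarithmic growth of the quantile function and exponential tails -/

theorem bddAbove_div_log_of_halving (μ : Measure ℝ)
    (h : BddAbove ((fun u : ℝ => quantile μ (1 - u / 2) - quantile μ (1 - u) + quantile μ u -
      quantile μ (u / 2)) '' Ioc 0 (1 / 2))) :
    BddAbove ((fun u : ℝ => (quantile μ (1 - u) - quantile μ u) / Real.log (1 / u)) ''
      Ioc 0 (1 / 2)) := by
  obtain ⟨C, hC, h1, h2⟩ := (bddAbove_halving_iff μ).1 h
  have hQ := monotoneOn_quantile μ
  have hl2 : 0 < Real.log 2 := Real.log_pos (by norm_num)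
  rw [bddAbove_image_iff_exists_nonneg]
  refine ⟨2 * C / Real.log 2, by positivity, fun u hu => ?_⟩
  have hu0 := hu.1
  have hlog : 0 < Real.log (1 / u) := Real.log_pos (by
    rw [lt_div_iff₀ hu0]; linarith [hu.2])
  have e1 := sub_le_log_of_sub_half_le hQ hC h1 hu0 hu.2 le_rfl
  have e2 := sub_le_log_of_sub_half_le hQ.reflect hC h2 hu0 hu.2 le_rfl
  simp only [reflect] at e2
  rw [show (1 : ℝ) - 1 / 2 = 1 / 2 by norm_num] at e2
  -- Starting from `1/2` rather than 1 saves one `log 2`, which absorbs the additive 1 of the growth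
  -- bound.
  have e3 : Real.log (1 / 2 / u) = Real.log (1 / u) - Real.log 2 := by
    rw [div_right_comm, Real.log_div (by positivity) (by norm_num)]
  rw [e3, sub_div, div_self hl2.ne'] at e1 e2
  rw [div_le_iff₀ hlog]
  have : 2 * C / Real.log 2 * Real.log (1 / u) =
    2 * (C * (1 + (Real.log (1 / u) / Real.log 2 - 1))) := by ring
  linarith

theorem exists_exp_tail_of_bddAbove_div_log (μ : Measure ℝ)
    (h : BddAbove ((fun u : ℝ => (quantile μ (1 - u) - quantile μ u) / Real.log (1 / u)) ''
      Ioc 0 (1 / 2))) :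
    ∃ l : ℝ, 0 < l ∧ ∀ x : ℝ, 0 ≤ x → cdf μ (-x) + 1 - cdf μ x ≤ Real.exp (-l * x) / l := by
  -- The constant is increased by 1 to make it positive, since it is divided by below.
  obtain ⟨C₀, hC₀, h0⟩ := bddAbove_image_iff_exists_nonneg.1 h
  set C := C₀ + 1 with hCdef
  have hC : 0 < C := by linarith
  have hQ := monotoneOn_quantile μ
  have hD : ∀ u ∈ Ioc (0 : ℝ) (1 / 2), quantile μ (1 - u) - quantile μ u ≤ C * Real.log (1 / u) := by
    intro u hu
    have hlog : 0 < Real.log (1 / u) := Real.log_pos (by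
      rw [lt_div_iff₀ hu.1]; linarith [hu.2])
    have := (div_le_iff₀ hlog).1 (h0 u hu)
    nlinarith
  set m := quantile μ (1 / 2) with hm
  have hhalf : (1 / 2 : ℝ) ∈ Ioo (0 : ℝ) 1 := by norm_num
  have left : ∀ x, cdf μ (-x) ≤ Real.exp ((|m| - x) / C) := by
    intro x
    set u := cdf μ (-x) with hu
    rcases (cdf_nonneg μ (-x)).eq_or_lt with h0 | hpos
    · rw [hu, ← h0]; positivity
    rcases le_or_gt u (1 / 2) with hle | hgt
    · have e1 : quantile μ u ≤ -x := (quantile_le_iff μ hpos (by linarith) _).2 le_rfl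
      have e2 : m ≤ quantile μ (1 - u) := hQ hhalf ⟨by linarith, by linarith⟩ (by linarith)
      have e3 := hD u ⟨hpos, hle⟩
      rw [one_div, Real.log_inv] at e3
      rw [← Real.log_le_iff_le_exp hpos, le_div_iff₀ hC]
      linarith [neg_abs_le m]
    · have e1 : m ≤ -x := (quantile_le_iff μ hhalf.1 hhalf.2 _).2 hgt.le
      refine (cdf_le_one μ (-x)).trans (Real.one_le_exp (div_nonneg ?_ hC.le))
      linarith [neg_abs_le m]
  -- Taking `1 - F(x)` itself as level would be useless, as it only gives `F⁻¹(F(x)) ≤ x`. The level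
  -- `p` is chosen with `C log(1/p) = x - |m|`, which forces `F⁻¹(1 - p) ≤ x`; the factor 2 covers
  -- `p ≥ 1/2`.
  have right : ∀ x, 1 - cdf μ x ≤ 2 * Real.exp ((|m| - x) / C) := by
    intro x
    set p := Real.exp ((|m| - x) / C) with hp
    have hp0 : 0 < p := Real.exp_pos _
    rcases le_or_gt (1 / 2) p with hle | hgt
    · linarith [cdf_nonneg μ x]
    · have e1 := hD p ⟨hp0, hgt.le⟩
      rw [one_div, Real.log_inv, hp, Real.log_exp] at e1
      rw [← hp] at e1
      have e2 : quantile μ p ≤ m := hQ ⟨hp0, by linarith⟩ hhalf hgt.le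
      have e3 : C * -((|m| - x) / C) = x - |m| := by field_simp; ring
      have e4 : quantile μ (1 - p) ≤ x := by linarith [le_abs_self m]
      have e5 := (quantile_le_iff μ (by linarith) (by linarith) _).1 e4
      linarith
  -- The first entry fixes the decay rate; the second absorbs the factor `exp(|m|/C)` and the total
  -- constant `3 = 1 + 2`.
  set l := min (1 / C) (Real.exp (-|m| / C) / 3) with hl
  have hl0 : 0 < l := lt_min (by positivity) (by positivity)
  refine ⟨l, hl0, fun x hx => ?_⟩
  rw [le_div_iff₀ hl0]
  have e1 : l * x ≤ x / C := by
    have := mul_le_mul_of_nonneg_right (min_le_left (1 / C) (Real.exp (-|m| / C) / 3)) hx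
    rw [one_div_mul_eq_div] at this
    exact this
  have e2 : Real.exp (-(x / C)) ≤ Real.exp (-l * x) := Real.exp_le_exp.2 (by linarith)
  have e3 : l ≤ Real.exp (-|m| / C) / 3 := min_le_right _ _
  have e4 : cdf μ (-x) + 1 - cdf μ x ≤ 3 * Real.exp ((|m| - x) / C) := by
    linarith [left x, right x]
  have e5 : Real.exp (-|m| / C) * Real.exp ((|m| - x) / C) = Real.exp (-(x / C)) := by
    rw [← Real.exp_add]; congr 1; ring
  calc (cdf μ (-x) + 1 - cdf μ x) * l ≤
        3 * Real.exp ((|m| - x) / C) * (Real.exp (-|m| / C) / 3) :=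
        mul_le_mul e4 e3 hl0.le (by positivity)
    _ = Real.exp (-(x / C)) := by rw [← e5]; ring
    _ ≤ _ := e2

/-- Exponential tails bound the quantile function logarithmically at both ends. -/
theorem exists_quantile_log_bound (μ : Measure ℝ)
    (h : ∃ l : ℝ, 0 < l ∧ ∀ x : ℝ, 0 ≤ x →
      cdf μ (-x) + 1 - cdf μ x ≤ Real.exp (-l * x) / l) :
    ∃ a b : ℝ, 0 ≤ a ∧ 0 ≤ b ∧ ∀ u ∈ Ioo (0 : ℝ) 1,
      -(a + b * Real.log (1 / u)) ≤ quantile μ u ∧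
        quantile μ (1 - u) ≤ a + b * Real.log (1 / u) := by
  obtain ⟨l, hl, h⟩ := h
  -- With `x = a + b log(1/u)` the tail bound at `x` falls below `u`; the extra 1 makes this strict,
  -- as the lower bound on `F⁻¹(u)` requires.
  refine ⟨|Real.log l| / l + 1, 1 / l, by positivity, by positivity, fun u hu => ?_⟩
  have hlog : 0 ≤ Real.log (1 / u) := Real.log_nonneg ((one_le_div hu.1).2 hu.2.le)
  set x := |Real.log l| / l + 1 + 1 / l * Real.log (1 / u) with hx
  have hx0 : 0 ≤ x := by positivity
  have hexp : Real.exp (-l * x) / l < u := by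
    rw [div_lt_iff₀ hl, ← Real.lt_log_iff_exp_lt (mul_pos hu.1 hl),
      Real.log_mul hu.1.ne' hl.ne']
    have : -l * x = -|Real.log l| - l + Real.log u := by
      rw [hx, one_div u, Real.log_inv]; field_simp; ring
    rw [this]
    linarith [neg_abs_le (Real.log l)]
  have hb := (h x hx0).trans_lt hexp
  constructor
  · by_contra! hlt
    have := (quantile_le_iff μ hu.1 hu.2 _).1 hlt.le
    linarith [cdf_le_one μ x]
  · rw [quantile_le_iff μ (by linarith [hu.2]) (by linarith [hu.1])]
    linarith [cdf_nonneg μ (-x)]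

theorem bddAbove_div_log_of_exp_tail (μ : Measure ℝ)
    (h : ∃ l : ℝ, 0 < l ∧ ∀ x : ℝ, 0 ≤ x →
      cdf μ (-x) + 1 - cdf μ x ≤ Real.exp (-l * x) / l) :
    BddAbove ((fun u : ℝ => (quantile μ (1 - u) - quantile μ u) / Real.log (1 / u)) ''
      Ioc 0 (1 / 2)) := by
  obtain ⟨a, b, ha, hb, h⟩ := exists_quantile_log_bound μ h
  have hl2 : 0 < Real.log 2 := Real.log_pos (by norm_num)
  refine bddAbove_image_iff_exists_nonneg.2
    ⟨2 * (a / Real.log 2 + b), by positivity, fun u hu => ?_⟩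
  have hu0 := hu.1
  have hlog : Real.log 2 ≤ Real.log (1 / u) := Real.log_le_log (by norm_num) (by
    rw [le_div_iff₀ hu0]; linarith [hu.2])
  rw [div_le_iff₀ (hl2.trans_le hlog)]
  obtain ⟨e1, e2⟩ := h u ⟨hu0, by linarith [hu.2]⟩
  have e3 : a ≤ a / Real.log 2 * Real.log (1 / u) := by
    rw [div_mul_eq_mul_div, le_div_iff₀ hl2]
    gcongr
  linarith

/-! ### The error of the midpoint quantile grid -/

theorem abs_le_log_bound {f : ℝ → ℝ} (hf : MonotoneOn f (Ioo 0 1)) {a b : ℝ} (hb : 0 ≤ b)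
    (h : ∀ u ∈ Ioo (0 : ℝ) 1, -(a + b * Real.log (1 / u)) ≤ f u ∧
      f (1 - u) ≤ a + b * Real.log (1 / u)) {u : ℝ} (hu : u ∈ Ioc (0 : ℝ) (1 / 2)) :
    |f u| ≤ a + b * Real.log (1 / u) := by
  have hu0 := hu.1
  have hhalf : (1 / 2 : ℝ) ∈ Ioo (0 : ℝ) 1 := by norm_num
  refine abs_le.2 ⟨(h u ⟨hu.1, by linarith [hu.2]⟩).1, ?_⟩
  have e1 : f u ≤ f (1 / 2) := hf ⟨hu.1, by linarith [hu.2]⟩ hhalf hu.2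
  have e2 := (h _ hhalf).2
  rw [show (1 : ℝ) - 1 / 2 = 1 / 2 by norm_num] at e2
  refine e1.trans (e2.trans ?_)
  gcongr
  exact hu.2

theorem reflect_log_bound {f : ℝ → ℝ} {a b : ℝ}
    (h : ∀ u ∈ Ioo (0 : ℝ) 1, -(a + b * Real.log (1 / u)) ≤ f u ∧
      f (1 - u) ≤ a + b * Real.log (1 / u)) :
    ∀ u ∈ Ioo (0 : ℝ) 1, -(a + b * Real.log (1 / u)) ≤ reflect f u ∧
      reflect f (1 - u) ≤ a + b * Real.log (1 / u) := fun u hu => by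
  simp only [reflect, sub_sub_cancel]
  constructor <;> linarith [(h u hu).1, (h u hu).2]

theorem natCast_mul_setLIntegral_le_of_log_bound {f : ℝ → ℝ} (hf : MonotoneOn f (Ioo 0 1))
    {ρ a b : ℝ} (hρ : 1 ≤ ρ) (ha : 0 ≤ a) (hb : 0 ≤ b)
    (h : ∀ u ∈ Ioo (0 : ℝ) 1, -(a + b * Real.log (1 / u)) ≤ f u ∧
      f (1 - u) ≤ a + b * Real.log (1 / u)) {N : ℕ} (hN : 2 ≤ N) :
    (N : ℝ≥0∞) * ∫⁻ u in Ioo 0 (1 / (N : ℝ)), edist (f u) (f (1 / (2 * N))) ^ ρ ≤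
      ENNReal.ofReal (2 * ((2 * a + 2 * b) * (1 + Real.log N) * (1 + 2 * ρ)) ^ ρ) := by
  have hN2 : (2 : ℝ) ≤ N := by exact_mod_cast hN
  have hN0 : (0 : ℝ) < N := by linarith
  have hl2 : 0 < Real.log 2 := Real.log_pos (by norm_num)
  have hl1 : Real.log 2 ≤ 1 := by linarith [Real.log_two_lt_d9]
  have hlN : 0 ≤ Real.log N := Real.log_nonneg (by linarith)
  have hle : 1 / (N : ℝ) ≤ 1 / 2 := by gcongr
  refine natCast_mul_setLIntegral_le hρ (by omega) (by positivity) fun u hu => ?_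
  have hu0 := hu.1
  have e1 := abs_le_log_bound hf hb h (u := u) ⟨hu.1, hu.2.le.trans hle⟩
  have e2 := abs_le_log_bound hf hb h (u := 1 / (2 * N))
    ⟨by positivity, by gcongr; linarith⟩
  rw [one_div_one_div, Real.log_mul (by norm_num) hN0.ne'] at e2
  have e3 : Real.log (1 / (N * u)) = Real.log (1 / u) - Real.log N := by
    rw [mul_comm, ← div_div, Real.log_div (by positivity) hN0.ne']
  have e4 : 0 ≤ Real.log (1 / (N * u)) := by
    refine Real.log_nonneg ((one_le_div (by positivity)).2 ?_)
    have := hu.2.le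
    rw [le_div_iff₀ hN0] at this
    linarith
  have e5 := abs_sub (f u) (f (1 / (2 * N)))
  have e6 : b * Real.log 2 ≤ b := mul_le_of_le_one_right hb hl1
  have e7 : (2 * a + 2 * b) * (1 + Real.log N) * (1 + Real.log (1 / (N * u))) =
      2 * a + 2 * b + 2 * b * Real.log N + b * Real.log (1 / (N * u)) + 2 * a * Real.log N +
        (2 * a + b + (2 * a + 2 * b) * Real.log N) * Real.log (1 / (N * u)) := by ring
  have e8 : 0 ≤ 2 * a * Real.log N +
        (2 * a + b + (2 * a + 2 * b) * Real.log N) * Real.log (1 / (N * u)) := by positivity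
  have e9 : b * Real.log (1 / u) = b * Real.log (1 / (N * u)) + b * Real.log N := by
    rw [e3]; ring
  linarith

theorem sum_Ioc_sub (G : ℝ → ℝ) {k : ℕ} (hk : 1 ≤ k) :
    ∑ i ∈ Finset.Ioc 1 k, (G i - G (i - 1)) = G k - G 1 := by
  induction k, hk using Nat.le_induction with
  | base => simp
  | succ k hk ih =>
    rw [Finset.sum_Ioc_succ_top hk, ih]
    push_cast
    rw [add_sub_cancel_right]
    ring

/-- The total error of a monotone function on the inner cells is controlled by its oscillation. -/
theorem natCast_mul_sum_lintegral_inner_le {f : ℝ → ℝ} (hf : MonotoneOn f (Ioo 0 1)) {ρ : ℝ}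
    (hρ : 1 ≤ ρ) {N : ℕ} (hN : 2 ≤ N) {x : ℕ → ℝ}
    (hx : ∀ i ∈ Finset.Ioc 1 (N - 1),
      x i ∈ Icc (f (((i : ℝ) - 1) / N)) (f ((i : ℝ) / N))) :
    (N : ℝ≥0∞) * ∑ i ∈ Finset.Ioc 1 (N - 1), ∫⁻ u, edist (f u) (x i) ^ ρ ∂(cell N i) ≤
      ENNReal.ofReal ((f (1 - 1 / N) - f (1 / N)) ^ ρ) := by
  have hN2 : (2 : ℝ) ≤ N := by exact_mod_cast hN
  have hN0 : (0 : ℝ) < N := by linarith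
  set L := f (1 - 1 / N) - f (1 / N) with hL
  have hmem1 : 1 / (N : ℝ) ∈ Ioo (0 : ℝ) 1 :=
    ⟨by positivity, by rw [div_lt_one hN0]; linarith⟩
  have hmem2 : 1 - 1 / (N : ℝ) ∈ Ioo (0 : ℝ) 1 :=
    ⟨by linarith [hmem1.2], by linarith [hmem1.1]⟩
  have hdiv : (((N - 1 : ℕ) : ℝ)) / N = 1 - 1 / N := by
    rw [Nat.cast_sub (by omega), sub_div, div_self hN0.ne', Nat.cast_one]
  have hL0 : 0 ≤ L := by
    refine sub_nonneg.2 (hf hmem1 hmem2 ?_)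
    have : 1 / (N : ℝ) ≤ 1 / 2 := by gcongr
    linarith
  -- Bounding `d^ρ` by `d * L^(ρ - 1)` makes the cell errors linear in the increments of `f`, so
  -- that their sum telescopes to `L^ρ`.
  have hcell : ∀ i ∈ Finset.Ioc 1 (N - 1),
      (N : ℝ≥0∞) * ∫⁻ u, edist (f u) (x i) ^ ρ ∂(cell N i) ≤
        ENNReal.ofReal ((f ((i : ℝ) / N) - f (((i : ℝ) - 1) / N)) * L ^ (ρ - 1)) := by
    intro i hi
    have hxi := hx i hi
    rw [Finset.mem_Ioc] at hi
    have hi1 : (2 : ℝ) ≤ i := by exact_mod_cast hi.1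
    have hiN : (i : ℝ) ≤ ((N - 1 : ℕ) : ℝ) := by exact_mod_cast hi.2
    have hlow : 1 / (N : ℝ) ≤ ((i : ℝ) - 1) / N := by gcongr; linarith
    have hmid : ((i : ℝ) - 1) / N ≤ (i : ℝ) / N := by gcongr; linarith
    have hhigh : (i : ℝ) / N ≤ 1 - 1 / N := by rw [← hdiv]; gcongr
    have ma : ((i : ℝ) - 1) / N ∈ Ioo (0 : ℝ) 1 :=
      ⟨hmem1.1.trans_le hlow, (hmid.trans hhigh).trans_lt hmem2.2⟩
    have mb : (i : ℝ) / N ∈ Ioo (0 : ℝ) 1 := ⟨ma.1.trans_le hmid, hhigh.trans_lt hmem2.2⟩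
    set d := f ((i : ℝ) / N) - f (((i : ℝ) - 1) / N) with hd
    have hd0 : 0 ≤ d := sub_nonneg.2 (hf ma mb hmid)
    have hdL : d ≤ L := by
      have := hf hmem1 ma hlow
      have := hf mb hmem2 hhigh
      linarith
    have hpt : ∀ᵐ u ∂(cell N i), edist (f u) (x i) ^ ρ ≤ ENNReal.ofReal (d * L ^ (ρ - 1)) := by
      filter_upwards [ae_restrict_mem measurableSet_Ioo] with u hu
      have mu : u ∈ Ioo (0 : ℝ) 1 := ⟨ma.1.trans hu.1, hu.2.trans mb.2⟩
      have h1 := hf ma mu hu.1.le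
      have h2 := hf mu mb hu.2.le
      have habs : |f u - x i| ≤ d := abs_le.2 ⟨by linarith [hxi.2], by linarith [hxi.1]⟩
      rw [edist_rpow_eq_ofReal (by linarith)]
      refine ENNReal.ofReal_le_ofReal ?_
      calc |f u - x i| ^ ρ ≤ d ^ ρ := Real.rpow_le_rpow (abs_nonneg _) habs (by linarith)
        _ = d * d ^ (ρ - 1) := by
            rw [← Real.rpow_one_add' hd0 (by linarith)]; congr 1; ring
        _ ≤ d * L ^ (ρ - 1) := by
            gcongr
    refine (mul_le_mul_right (lintegral_mono_ae hpt) _).trans ?_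
    rw [lintegral_const, cell_univ (by omega), mul_comm, mul_assoc,
      ENNReal.inv_mul_cancel (by simp; omega) (ENNReal.natCast_ne_top N), mul_one]
  rw [Finset.mul_sum]
  refine (Finset.sum_le_sum hcell).trans_eq ?_
  have hnn : ∀ i ∈ Finset.Ioc 1 (N - 1),
      0 ≤ (f ((i : ℝ) / N) - f (((i : ℝ) - 1) / N)) * L ^ (ρ - 1) := fun i hi =>
    mul_nonneg (sub_nonneg.2 ((hx i hi).1.trans (hx i hi).2)) (by positivity)
  rw [← ENNReal.ofReal_sum_of_nonneg hnn, ← Finset.sum_mul,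
    sum_Ioc_sub (fun t => f (t / N)) (by omega), hdiv, ← hL,
    ← Real.rpow_one_add' hL0 (by linarith)]
  congr 2
  ring

theorem exists_natCast_mul_gridCost_le {μ : Measure ℝ} {ρ : ℝ} (hρ : 1 ≤ ρ)
    (h : ∃ l : ℝ, 0 < l ∧ ∀ x : ℝ, 0 ≤ x →
      cdf μ (-x) + 1 - cdf μ x ≤ Real.exp (-l * x) / l) :
    ∃ K : ℝ, 0 ≤ K ∧ ∀ N : ℕ, 2 ≤ N → ∃ x : ℕ → ℝ,
      (N : ℝ≥0∞) * gridCost μ ρ N x ≤ ENNReal.ofReal (K * (1 + Real.log N) ^ ρ) := by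
  obtain ⟨a, b, ha, hb, hab⟩ := exists_quantile_log_bound μ h
  have hQ := monotoneOn_quantile μ
  -- The 5 collects 2 from each extreme cell and 1 from all the inner cells.
  refine ⟨5 * ((2 * a + 2 * b) * (1 + 2 * ρ)) ^ ρ, by positivity, fun N hN => ?_⟩
  have hN2 : (2 : ℝ) ≤ N := by exact_mod_cast hN
  have hN0 : (0 : ℝ) < N := by linarith
  have hlN : 0 ≤ Real.log N := Real.log_nonneg (by linarith)
  have hhalf : 1 / (N : ℝ) ≤ 1 / 2 := by gcongr
  have hmem : 1 / (N : ℝ) ∈ Ioc (0 : ℝ) (1 / 2) := ⟨by positivity, hhalf⟩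
  set x : ℕ → ℝ := fun i => quantile μ ((i - 1 / 2) / N) with hx
  refine ⟨x, ?_⟩
  set E := ((2 * a + 2 * b) * (1 + Real.log N) * (1 + 2 * ρ)) ^ ρ with hE
  have hE0 : 0 ≤ E := by positivity
  have hsplit : Finset.Icc 1 N = insert 1 (insert N (Finset.Ioc 1 (N - 1))) := by
    ext i
    simp only [Finset.mem_Icc, Finset.mem_insert, Finset.mem_Ioc]
    omega
  have hfirst : (N : ℝ≥0∞) * ∫⁻ u, edist (quantile μ u) (x 1) ^ ρ ∂(cell N 1) ≤
      ENNReal.ofReal (2 * E) := by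
    have e : x 1 = quantile μ (1 / (2 * N)) := by
      simp only [hx]; congr 1; push_cast; field_simp; norm_num
    rw [lintegral_cell_one, e]
    exact natCast_mul_setLIntegral_le_of_log_bound hQ hρ ha hb hab hN
  have hlast : (N : ℝ≥0∞) * ∫⁻ u, edist (quantile μ u) (x N) ^ ρ ∂(cell N N) ≤
      ENNReal.ofReal (2 * E) := by
    have e : -x N = reflect (quantile μ) (1 / (2 * N)) := by
      simp only [hx, reflect]; congr 2; field_simp
    rw [lintegral_cell_self _ _ _ (by omega), e]
    exact natCast_mul_setLIntegral_le_of_log_bound hQ.reflect hρ ha hb (reflect_log_bound hab) hN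
  have hinner : (N : ℝ≥0∞) * ∑ i ∈ Finset.Ioc 1 (N - 1),
      ∫⁻ u, edist (quantile μ u) (x i) ^ ρ ∂(cell N i) ≤ ENNReal.ofReal E := by
    refine (natCast_mul_sum_lintegral_inner_le hQ hρ hN fun i hi => ?_).trans
      (ENNReal.ofReal_le_ofReal ?_)
    · rw [Finset.mem_Ioc] at hi
      have hi1 : (2 : ℝ) ≤ i := by exact_mod_cast hi.1
      have hi2 : (i : ℝ) + 1 ≤ N := by exact_mod_cast (by omega : i + 1 ≤ N)
      have m0 : ((i : ℝ) - 1) / N ∈ Ioo (0 : ℝ) 1 :=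
        ⟨div_pos (by linarith) hN0, (div_lt_one hN0).2 (by linarith)⟩
      have m1 : ((i : ℝ) - 1 / 2) / N ∈ Ioo (0 : ℝ) 1 :=
        ⟨div_pos (by linarith) hN0, (div_lt_one hN0).2 (by linarith)⟩
      have m2 : (i : ℝ) / N ∈ Ioo (0 : ℝ) 1 :=
        ⟨div_pos (by linarith) hN0, (div_lt_one hN0).2 (by linarith)⟩
      exact ⟨hQ m0 m1 (by gcongr; norm_num), hQ m1 m2 (by gcongr; linarith)⟩
    · have m1 : 1 / (N : ℝ) ∈ Ioo (0 : ℝ) 1 := ⟨hmem.1, by linarith⟩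
      have e1 := hab _ m1
      have hle : quantile μ (1 / N) ≤ quantile μ (1 - 1 / N) :=
        hQ m1 ⟨by linarith, by linarith [m1.1]⟩ (by linarith)
      rw [one_div_one_div] at e1
      refine Real.rpow_le_rpow (by linarith) ?_ (by linarith)
      calc quantile μ (1 - 1 / N) - quantile μ (1 / N) ≤ 2 * a + 2 * b * Real.log N := by
            linarith [e1.1, e1.2]
        _ ≤ (2 * a + 2 * b) * (1 + Real.log N) := by
            have : 0 ≤ 2 * b + 2 * a * Real.log N := by positivity
            linarith
        _ ≤ _ := le_mul_of_one_le_right (by positivity) (by linarith)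
  rw [gridCost, hsplit, Finset.sum_insert (by simp; omega), Finset.sum_insert (by simp; omega),
    mul_add, mul_add]
  refine (add_le_add hfirst (add_le_add hlast hinner)).trans_eq ?_
  rw [← ENNReal.ofReal_add (by positivity) hE0, ← ENNReal.ofReal_add (by positivity) (by positivity)]
  congr 1
  have : E = ((2 * a + 2 * b) * (1 + 2 * ρ)) ^ ρ * (1 + Real.log N) ^ ρ := by
    rw [← Real.mul_rpow (by positivity) (by positivity), hE]
    congr 1
    ring
  rw [this]
  ring

theorem iSup_minError_div_log_lt_top {μ : Measure ℝ} [IsProbabilityMeasure μ] {ρ : ℝ}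
    (hρ : 1 ≤ ρ) (hμ : Integrable (fun x : ℝ => |x| ^ ρ) μ)
    (h : ∃ l : ℝ, 0 < l ∧ ∀ x : ℝ, 0 ≤ x →
      cdf μ (-x) + 1 - cdf μ x ≤ Real.exp (-l * x) / l) :
    (⨆ (N : ℕ) (_ : 1 ≤ N),
      ENNReal.ofReal ((N : ℝ) ^ (1 / ρ) / (1 + Real.log (N : ℝ))) * minError μ ρ N) < ⊤ := by
  obtain ⟨K, hK, hgrid⟩ := exists_natCast_mul_gridCost_le hρ h
  have hρ0 : 0 < ρ := by linarith
  have hone : minError μ ρ 1 < ⊤ :=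
    (minError_le hρ le_rfl fun _ => 0).trans_lt
      (ENNReal.rpow_lt_top_of_nonneg (by positivity) (gridCost_lt_top hρ hμ _).ne)
  refine lt_of_le_of_lt (b := minError μ ρ 1 + ENNReal.ofReal K ^ (1 / ρ))
    (iSup₂_le fun N hN => ?_) (ENNReal.add_lt_top.2 ⟨hone,
      ENNReal.rpow_lt_top_of_nonneg (by positivity) ENNReal.ofReal_ne_top⟩)
  -- For `N = 1` the normalising factor is 1 and the term is the finite `minError μ ρ 1`.
  rcases hN.eq_or_lt with rfl | hN2
  · simp
  refine le_trans ?_ le_add_self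
  obtain ⟨x, hx⟩ := hgrid N hN2
  have hlog : 0 ≤ Real.log N := Real.log_nonneg (by exact_mod_cast hN)
  set c := 1 + Real.log N with hc
  have hc0 : 0 < c := by linarith
  have e1 : ENNReal.ofReal ((N : ℝ) ^ (1 / ρ) / c) =
      ((N : ℝ≥0∞) * ENNReal.ofReal (c ^ ρ)⁻¹) ^ (1 / ρ) := by
    rw [← ENNReal.ofReal_natCast, ← ENNReal.ofReal_mul (by positivity),
      ENNReal.ofReal_rpow_of_nonneg (by positivity) (by positivity),
      Real.mul_rpow (by positivity) (by positivity), Real.inv_rpow (by positivity),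
      ← Real.rpow_mul hc0.le, mul_one_div_cancel hρ0.ne', Real.rpow_one, div_eq_mul_inv]
  calc ENNReal.ofReal ((N : ℝ) ^ (1 / ρ) / c) * minError μ ρ N
      ≤ ((N : ℝ≥0∞) * ENNReal.ofReal (c ^ ρ)⁻¹) ^ (1 / ρ) * gridCost μ ρ N x ^ (1 / ρ) := by
        rw [e1]
        exact mul_le_mul_right (minError_le hρ hN x) _
    _ = (ENNReal.ofReal (c ^ ρ)⁻¹ * ((N : ℝ≥0∞) * gridCost μ ρ N x)) ^ (1 / ρ) := by
        rw [← ENNReal.mul_rpow_of_nonneg _ _ (by positivity)]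
        congr 1
        ring
    _ ≤ (ENNReal.ofReal (c ^ ρ)⁻¹ * ENNReal.ofReal (K * c ^ ρ)) ^ (1 / ρ) :=
        ENNReal.rpow_le_rpow (mul_le_mul_right hx _) (by positivity)
    _ = ENNReal.ofReal K ^ (1 / ρ) := by
        rw [← ENNReal.ofReal_mul (by positivity)]
        congr 2
        field_simp

end WassersteinGrid

theorem proposition4 (μ : MeasureTheory.Measure ℝ) [MeasureTheory.IsProbabilityMeasure μ]
    (ρ : ℝ) (hρ : 1 ≤ ρ) (hμ : MeasureTheory.Integrable (fun x : ℝ => |x| ^ ρ) μ) :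
    -- optimal points exist for every `N ≥ 1`
    (∀ N : ℕ, 1 ≤ N → ∃ x : ℕ → ℝ, WassersteinGrid.IsOptimalGrid μ ρ N x) ∧
    -- for every choice of optimal points: the implication and the equivalence on the extreme cells
    (∀ x : ℕ → ℕ → ℝ, (∀ N : ℕ, 1 ≤ N → WassersteinGrid.IsOptimalGrid μ ρ N (x N)) →
      ((⨆ (N : ℕ) (_ : 1 ≤ N),
            ENNReal.ofReal ((N : ℝ) ^ (1 / ρ)) * WassersteinGrid.minError μ ρ N) < ⊤ →
        (⨆ (N : ℕ) (_ : 1 ≤ N), (N : ENNReal) *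
            (WassersteinGrid.cellError μ ρ 0 (1 / (N : ℝ)) (x N 1) +
              WassersteinGrid.cellError μ ρ (((N : ℝ) - 1) / (N : ℝ)) 1 (x N N))) < ⊤) ∧
      ((⨆ (N : ℕ) (_ : 1 ≤ N), (N : ENNReal) *
            (WassersteinGrid.cellError μ ρ 0 (1 / (N : ℝ)) (x N 1) +
              WassersteinGrid.cellError μ ρ (((N : ℝ) - 1) / (N : ℝ)) 1 (x N N))) < ⊤ ↔
        BddAbove ((fun u : ℝ =>
          WassersteinGrid.quantile μ (1 - u / 2) - WassersteinGrid.quantile μ (1 - u) +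
            WassersteinGrid.quantile μ u - WassersteinGrid.quantile μ (u / 2)) ''
          Set.Ioc 0 (1 / 2)))) ∧
    (BddAbove ((fun u : ℝ =>
          WassersteinGrid.quantile μ (1 - u / 2) - WassersteinGrid.quantile μ (1 - u) +
            WassersteinGrid.quantile μ u - WassersteinGrid.quantile μ (u / 2)) ''
          Set.Ioc 0 (1 / 2)) →
      BddAbove ((fun u : ℝ =>
          (WassersteinGrid.quantile μ (1 - u) - WassersteinGrid.quantile μ u) /
            Real.log (1 / u)) '' Set.Ioc 0 (1 / 2))) ∧
    (BddAbove ((fun u : ℝ =>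
          (WassersteinGrid.quantile μ (1 - u) - WassersteinGrid.quantile μ u) /
            Real.log (1 / u)) '' Set.Ioc 0 (1 / 2)) ↔
      ∃ l : ℝ, 0 < l ∧ ∀ x : ℝ, 0 ≤ x →
        ProbabilityTheory.cdf μ (-x) + 1 - ProbabilityTheory.cdf μ x ≤ Real.exp (-l * x) / l) ∧
    ((∃ l : ℝ, 0 < l ∧ ∀ x : ℝ, 0 ≤ x →
        ProbabilityTheory.cdf μ (-x) + 1 - ProbabilityTheory.cdf μ x ≤ Real.exp (-l * x) / l) →
      (⨆ (N : ℕ) (_ : 1 ≤ N),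
        ENNReal.ofReal ((N : ℝ) ^ (1 / ρ) / (1 + Real.log (N : ℝ))) *
          WassersteinGrid.minError μ ρ N) < ⊤) := by
  open WassersteinGrid in
  exact ⟨fun N hN => exists_isOptimalGrid hρ hμ hN,
    fun x hx => ⟨iSup_extremeCost_lt_top_of_minError hρ hμ hx,
      bddAbove_halving_of_iSup_extremeCost hρ,
      iSup_extremeCost_lt_top_of_bddAbove_halving hρ hμ hx⟩,
    bddAbove_div_log_of_halving μ,
    ⟨exists_exp_tail_of_bddAbove_div_log μ, bddAbove_div_log_of_exp_tail μ⟩,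
    iSup_minError_div_log_lt_top hρ hμ⟩
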